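/- Let $p\geqslant 1$, $m\geqslant 1$ and $n$ be integers such that either $m\geqslant 2$ and $0\leqslant n\leqslant 3$, or $m=1$ and $n\in\mathbb N$ is arbitrary. Let $F\colon\mathbb R^p\to\mathbb C$ be of class $C^\infty$ on $\mathbb R^p\setminus\{0\}$ and homogeneous of degree $m$ in the sense that $$F(\lambda y)=\lambda^m F(y)\qquad\text{for all }\lambda\geqslant 0\text{ and all }y\in\mathbb R^p .$$ For $f\in L^2(\mathbb R^n)$ with values in a finite-dimensional space, write $f\in H^m(\mathbb R^n)$ if $(1+|\xi|^2)^{m/2}\widehat f\in L^2(\mathbb R^n)$, where $\widehat f(\xi)=\int_{\mathbb{R}^n} e^{-2\pi i x\cdot\xi}f(x)\,dx$ (extended to $L^2$), and put $\|f\|_{H^m}=\|(1+|\xi|^2)^{m/2}\widehat f\|_{L^2}$. Then there exists a constant $K>0$, depending only on $F$, $m$, $n$ and $p$, such that for every $u\in H^m(\mathbb R^n)$ with values in $\mathbb R^p$ one has $F(u)\in H^m(\mathbb R^n)$ and $$\|F(u)\|_{H^m}\leqslant K\,\|u\|_{H^m}^m .$$ -/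

import Mathlib

open MeasureTheory
open scoped ContDiff SchwartzMap

/-- `f ∈ H^m(ℝⁿ; V)`: `f` is square integrable and the tempered distribution it defines belongs to
the `L²`-based Sobolev space of order `m`, i.e. `𝓕⁻¹ (1 + |ξ|²)^(m/2) 𝓕 f ∈ L²`. -/
def MemH {n : ℕ} {V : Type*} [NormedAddCommGroup V] [NormedSpace ℂ V] [CompleteSpace V]
    (m : ℕ) (f : EuclideanSpace ℝ (Fin n) → V) : Prop :=
  ∃ hf : MemLp f 2 (volume : Measure (EuclideanSpace ℝ (Fin n))),
    TemperedDistribution.MemSobolev (m : ℝ) 2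
      ((hf.toLp f : Lp V 2 (volume : Measure (EuclideanSpace ℝ (Fin n)))) :
        𝓢'(EuclideanSpace ℝ (Fin n), V))

/-- The norm of `H^m(ℝⁿ; V)`: the `L²` norm of `g = 𝓕⁻¹ (1 + |ξ|²)^(m/2) 𝓕 f`. For `f ∈ H^m` there
is exactly one such `g` in `L²` (see `normH_eq`), so the infimum is over a one-point set. -/
noncomputable def normH {n : ℕ} {V : Type*} [NormedAddCommGroup V] [NormedSpace ℂ V]
    [CompleteSpace V] (m : ℕ) (f : EuclideanSpace ℝ (Fin n) → V) : ℝ :=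
  sInf {r : ℝ | ∃ (hf : MemLp f 2 (volume : Measure (EuclideanSpace ℝ (Fin n))))
    (g : Lp V 2 (volume : Measure (EuclideanSpace ℝ (Fin n)))),
    TemperedDistribution.besselPotential (EuclideanSpace ℝ (Fin n)) V (m : ℝ)
      ((hf.toLp f : Lp V 2 (volume : Measure (EuclideanSpace ℝ (Fin n)))) :
        𝓢'(EuclideanSpace ℝ (Fin n), V)) = (g : 𝓢'(EuclideanSpace ℝ (Fin n), V)) ∧ r = ‖g‖}

theorem normH_eq {n : ℕ} {V : Type*} [NormedAddCommGroup V] [NormedSpace ℂ V] [CompleteSpace V]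
    (m : ℕ) (f : EuclideanSpace ℝ (Fin n) → V)
    (hf : MemLp f 2 (volume : Measure (EuclideanSpace ℝ (Fin n))))
    (g : Lp V 2 (volume : Measure (EuclideanSpace ℝ (Fin n))))
    (h : TemperedDistribution.besselPotential (EuclideanSpace ℝ (Fin n)) V (m : ℝ)
      ((hf.toLp f : Lp V 2 (volume : Measure (EuclideanSpace ℝ (Fin n)))) :
        𝓢'(EuclideanSpace ℝ (Fin n), V)) = (g : 𝓢'(EuclideanSpace ℝ (Fin n), V))) :
    normH m f = ‖g‖ := by
  have key : ∀ g' : Lp V 2 (volume : Measure (EuclideanSpace ℝ (Fin n))),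
      (g : 𝓢'(EuclideanSpace ℝ (Fin n), V)) = (g' : 𝓢'(EuclideanSpace ℝ (Fin n), V)) →
      g = g' := by
    intro g' hg
    have hinj := LinearMap.ker_eq_bot.mp
      (Lp.ker_toTemperedDistributionCLM_eq_bot (E := EuclideanSpace ℝ (Fin n)) (F := V)
        (μ := (volume : Measure (EuclideanSpace ℝ (Fin n)))) (p := 2))
    exact hinj hg
  have hset : {r : ℝ | ∃ (hf : MemLp f 2 (volume : Measure (EuclideanSpace ℝ (Fin n))))
      (g : Lp V 2 (volume : Measure (EuclideanSpace ℝ (Fin n)))),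
      TemperedDistribution.besselPotential (EuclideanSpace ℝ (Fin n)) V (m : ℝ)
        ((hf.toLp f : Lp V 2 (volume : Measure (EuclideanSpace ℝ (Fin n)))) :
          𝓢'(EuclideanSpace ℝ (Fin n), V)) = (g : 𝓢'(EuclideanSpace ℝ (Fin n), V)) ∧
        r = ‖g‖} = {‖g‖} := by
    ext r
    constructor
    · rintro ⟨hf', g', hg', rfl⟩
      rw [key g' (h.symm.trans hg')]
      rfl
    · rintro rfl
      exact ⟨hf, g, h, rfl⟩
  rw [normH, hset, csInf_singleton]

/-- An `ℝᵖ`-valued function regarded as a `ℂᵖ`-valued one (coordinatewise, so that the Euclidean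
norms agree). -/
noncomputable def complexify {n p : ℕ}
    (u : EuclideanSpace ℝ (Fin n) → EuclideanSpace ℝ (Fin p)) :
    EuclideanSpace ℝ (Fin n) → EuclideanSpace ℂ (Fin p) :=
  fun x => WithLp.toLp 2 (fun i => ((u x i : ℝ) : ℂ))

/-! Only the origin is singular for `F`. Cutting it off at scale `ε` gives smooth `G` that agree
with `F` where `‖y‖ ≥ ε` and satisfy `‖D^j G(y)‖ ≤ C‖y‖^(m-j)` for `j ≤ m`, with `C` independent of
`ε` by scaling (`exists_smooth_approx_of_homogeneous`).

Let `v` be the real part of the Bessel potential of order `-m` of a Schwartz function `g`. By Faà di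
Bruno, `D^m(G ∘ v)` is bounded by a sum over partitions `c` of `C‖v‖^(m-|c|) ∏ ‖D^(c_i) v‖`. In
dimension at most 3, `H² ⊂ L^∞` bounds derivatives of order at most `m - 2` uniformly, so every
factor goes into `L^∞` except that of the largest part, which goes into `L²`. The one exception is
the partition `1 + 1` of `m = 2`, where a Gagliardo–Nirenberg inequality puts `‖Dv‖²` in `L²`. For
`m = 1` there is a single factor and no embedding is needed, hence no restriction on the dimension.
The outcome is `exists_bessel_comp_bound`: the `H^m` norm of `G ∘ v` is at most `K‖g‖^m`, uniformly
in `ε`.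

Finally `ε → 0` while `g` runs through Schwartz functions approximating the potential of `u`. The
compositions converge to `F(u)` in `L²`, and Fatou's lemma on the Fourier side keeps the bound
(`exists_besselPotential_eq_of_tendsto`). -/

open FourierTransform LineDeriv
open scoped ENNReal

/-! ### Fourier multipliers on Schwartz functions: `L²` and sup bounds, derivatives. -/

section FourierMultiplier

variable {E V : Type*} [NormedAddCommGroup E] [InnerProductSpace ℝ E]

theorem Function.HasTemperateGrowth.prod_inner {j : ℕ} (v : Fin j → E) :
    (fun ξ : E => ∏ i, inner ℝ ξ (v i)).HasTemperateGrowth := by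
  induction j with
  | zero => simp [Function.HasTemperateGrowth.const]
  | succ j ih =>
    simp only [Fin.prod_univ_succ]
    have := ih (fun i => v i.succ)
    fun_prop

variable [FiniteDimensional ℝ E]
  [MeasurableSpace E] [BorelSpace E] [NormedAddCommGroup V] [InnerProductSpace ℂ V]

theorem SchwartzMap.ofReal_norm_toLp_two (f : 𝓢(E, V)) :
    ENNReal.ofReal ‖f.toLp 2‖ = eLpNorm f 2 volume := by
  rw [SchwartzMap.norm_toLp, ENNReal.ofReal_toReal (f.eLpNorm_lt_top 2 volume).ne]

theorem SchwartzMap.enorm_fourierInv_le (f : 𝓢(E, V)) (x : E) :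
    ‖(𝓕⁻ f : 𝓢(E, V)) x‖ₑ ≤ eLpNorm f 1 volume := by
  rw [SchwartzMap.fourierInv_apply_eq]
  have := SchwartzMap.norm_fourier_apply_le_toLp_one f (-x)
  rw [SchwartzMap.norm_toLp] at this
  rw [← ofReal_norm, ← ENNReal.ofReal_toReal (f.eLpNorm_lt_top 1 volume).ne]
  exact ENNReal.ofReal_le_ofReal this

variable [CompleteSpace V]

theorem SchwartzMap.eLpNorm_fourier_two (f : 𝓢(E, V)) :
    eLpNorm (𝓕 f : 𝓢(E, V)) 2 volume = eLpNorm f 2 volume := by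
  rw [← SchwartzMap.ofReal_norm_toLp_two, ← SchwartzMap.ofReal_norm_toLp_two,
    SchwartzMap.norm_fourier_toL2_eq]

theorem SchwartzMap.fourier_fourierMultiplierCLM {σ : E → ℝ} (hσ : σ.HasTemperateGrowth)
    (g : 𝓢(E, V)) (ξ : E) :
    (𝓕 (fourierMultiplierCLM V σ g) : 𝓢(E, V)) ξ = σ ξ • (𝓕 g : 𝓢(E, V)) ξ := by
  rw [fourierMultiplierCLM_apply, FourierTransform.fourier_fourierInv_eq,
    smulLeftCLM_apply_apply hσ]

theorem SchwartzMap.eLpNorm_fourierMultiplierCLM_le {σ : E → ℝ} (hσ : σ.HasTemperateGrowth)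
    {C : ℝ} (hC : ∀ ξ, |σ ξ| ≤ C) (g : 𝓢(E, V)) :
    eLpNorm (fourierMultiplierCLM V σ g) 2 volume ≤ ENNReal.ofReal C * eLpNorm g 2 volume := by
  rw [← SchwartzMap.eLpNorm_fourier_two, ← SchwartzMap.eLpNorm_fourier_two g]
  refine eLpNorm_le_mul_eLpNorm_of_ae_le_mul (Filter.Eventually.of_forall fun ξ => ?_) 2
  rw [SchwartzMap.fourier_fourierMultiplierCLM hσ, norm_smul, Real.norm_eq_abs]
  gcongr
  exact hC ξ

/-- Fourier inversion bounds the value by the `L¹` norm of `σ · 𝓕 g`; Cauchy–Schwarz and Plancherel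
do the rest. With a square-integrable symbol this is the Sobolev embedding into `L^∞`. -/
theorem SchwartzMap.enorm_fourierMultiplierCLM_apply_le {σ : E → ℝ}
    (hσ : σ.HasTemperateGrowth) (g : 𝓢(E, V)) (x : E) :
    ‖fourierMultiplierCLM V σ g x‖ₑ ≤ eLpNorm σ 2 volume * eLpNorm g 2 volume := by
  rw [fourierMultiplierCLM_apply]
  refine (SchwartzMap.enorm_fourierInv_le _ x).trans ?_
  rw [← SchwartzMap.eLpNorm_fourier_two g]
  have h : ⇑(smulLeftCLM V σ (𝓕 g : 𝓢(E, V))) = σ • ⇑(𝓕 g : 𝓢(E, V)) := by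
    ext ξ
    simp [smulLeftCLM_apply_apply hσ]
  rw [h]
  exact eLpNorm_smul_le_mul_eLpNorm (𝓕 g : 𝓢(E, V)).continuous.aestronglyMeasurable
    hσ.1.continuous.aestronglyMeasurable

theorem SchwartzMap.iteratedLineDerivOp_fourierMultiplierCLM {σ : E → ℝ}
    (hσ : σ.HasTemperateGrowth) (g : 𝓢(E, V)) {j : ℕ} (v : Fin j → E) :
    ∂^{v} (fourierMultiplierCLM V σ g) =
      (2 * Real.pi * Complex.I) ^ j •
        fourierMultiplierCLM V (fun ξ => (∏ i, inner ℝ ξ (v i)) * σ ξ) g := by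
  induction j with
  | zero => simp
  | succ j ih =>
    have hp : (fun ξ : E => (∏ i, inner ℝ ξ (Fin.tail v i)) * σ ξ).HasTemperateGrowth :=
      (Function.HasTemperateGrowth.prod_inner _).mul hσ
    rw [iteratedLineDerivOp_succ_left, ih, lineDerivOp_smul, lineDeriv_eq_fourierMultiplierCLM,
      fourierMultiplierCLM_fourierMultiplierCLM_apply (by fun_prop) hp, smul_smul, ← pow_succ]
    congr 3
    ext ξ
    simp only [Pi.mul_apply, Fin.prod_univ_succ, Fin.tail]
    ring

theorem SchwartzMap.iteratedFDeriv_fourierMultiplierCLM_apply {σ : E → ℝ}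
    (hσ : σ.HasTemperateGrowth) (g : 𝓢(E, V)) {j : ℕ} (v : Fin j → E) (x : E) :
    iteratedFDeriv ℝ j (fourierMultiplierCLM V σ g) x v =
      (2 * Real.pi * Complex.I) ^ j •
        fourierMultiplierCLM V (fun ξ => (∏ i, inner ℝ ξ (v i)) * σ ξ) g x := by
  rw [← SchwartzMap.iteratedLineDerivOp_eq_iteratedFDeriv,
    SchwartzMap.iteratedLineDerivOp_fourierMultiplierCLM hσ, smul_apply]

end FourierMultiplier

/-- Expand every argument in the basis. This reduces a full derivative to finitely many mixed
partials, each of which is a Fourier multiplier. -/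
theorem ContinuousMultilinearMap.norm_le_sum_orthonormalBasis {E V ι : Type*}
    [NormedAddCommGroup E] [InnerProductSpace ℝ E] [NormedAddCommGroup V] [NormedSpace ℝ V]
    [Fintype ι] [DecidableEq ι] (b : OrthonormalBasis ι ℝ E) {j : ℕ}
    (f : ContinuousMultilinearMap ℝ (fun _ : Fin j => E) V) :
    ‖f‖ ≤ ∑ r : Fin j → ι, ‖f (fun i => b (r i))‖ := by
  refine f.opNorm_le_bound (Finset.sum_nonneg fun _ _ => norm_nonneg _) fun x => ?_
  have hx : x = fun i => ∑ k, inner ℝ (b k) (x i) • b k := by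
    ext1 i
    exact (b.sum_repr' (x i)).symm
  have hf : f x = ∑ r : Fin j → ι, (∏ i, inner ℝ (b (r i)) (x i)) • f (fun i => b (r i)) := by
    conv_lhs => rw [hx]
    rw [f.map_sum]
    exact Finset.sum_congr rfl fun r _ => f.map_smul_univ _ _
  rw [hf, Finset.sum_mul]
  refine (norm_sum_le _ _).trans (Finset.sum_le_sum fun r _ => ?_)
  rw [norm_smul, mul_comm, norm_prod]
  refine mul_le_mul_of_nonneg_left ?_ (norm_nonneg _)
  refine Finset.prod_le_prod (fun _ _ => norm_nonneg _) fun i _ => ?_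
  simpa using norm_inner_le_norm (𝕜 := ℝ) (b (r i)) (x i)

/-! ### Derivatives of Bessel potentials in `L²` and in `L^∞`. -/

section Bessel

variable {E : Type*} [NormedAddCommGroup E]

/-- The symbol `(1 + ‖ξ‖²)^(s/2)` of the Bessel potential of order `s`. -/
noncomputable def besselSymbol (s : ℝ) (ξ : E) : ℝ := (1 + ‖ξ‖ ^ 2) ^ (s / 2)

theorem besselSymbol_pos (s : ℝ) (ξ : E) : 0 < besselSymbol s ξ := by
  unfold besselSymbol; positivity

theorem besselSymbol_add (s t : ℝ) (ξ : E) :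
    besselSymbol (s + t) ξ = besselSymbol s ξ * besselSymbol t ξ := by
  unfold besselSymbol
  rw [← Real.rpow_add (by positivity)]
  ring_nf

theorem besselSymbol_zero (ξ : E) : besselSymbol 0 ξ = 1 := by simp [besselSymbol]

theorem besselSymbol_le_one {s : ℝ} (hs : s ≤ 0) (ξ : E) : besselSymbol s ξ ≤ 1 :=
  Real.rpow_le_one_of_one_le_of_nonpos (by simp) (by linarith)

theorem norm_pow_le_besselSymbol (j : ℕ) (ξ : E) : ‖ξ‖ ^ j ≤ besselSymbol j ξ := by
  have h : ‖ξ‖ ≤ (1 + ‖ξ‖ ^ 2) ^ (1 / 2 : ℝ) := by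
    rw [← Real.sqrt_eq_rpow]
    exact Real.le_sqrt_of_sq_le (by linarith)
  calc ‖ξ‖ ^ j ≤ ((1 + ‖ξ‖ ^ 2) ^ (1 / 2 : ℝ)) ^ j := by gcongr
    _ = besselSymbol j ξ := by
      rw [besselSymbol, ← Real.rpow_mul_natCast (by positivity)]
      ring_nf

variable [InnerProductSpace ℝ E]

theorem besselSymbol_hasTemperateGrowth (s : ℝ) :
    (besselSymbol s : E → ℝ).HasTemperateGrowth := by
  unfold besselSymbol; fun_prop

/-- Used with `t = 0`, a bounded symbol giving `L²` estimates, and with `t = -2`, a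
square-integrable symbol giving sup estimates. -/
theorem abs_prod_inner_mul_besselSymbol_le {ι : Type*} [Fintype ι] (b : OrthonormalBasis ι ℝ E)
    {j : ℕ} (r : Fin j → ι) {s t : ℝ} (hs : j + s ≤ t) (ξ : E) :
    |(∏ i, inner ℝ ξ (b (r i))) * besselSymbol s ξ| ≤ besselSymbol t ξ := by
  have h1 : |∏ i, inner ℝ ξ (b (r i))| ≤ ‖ξ‖ ^ j := by
    rw [Finset.abs_prod]
    refine (Finset.prod_le_prod (fun _ _ => abs_nonneg _) (g := fun _ => ‖ξ‖) fun i _ => ?_).trans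
      (by simp)
    simpa using abs_real_inner_le_norm ξ (b (r i))
  rw [abs_mul, abs_of_pos (besselSymbol_pos s ξ)]
  calc _ ≤ besselSymbol j ξ * besselSymbol s ξ := by
        gcongr
        · exact (besselSymbol_pos s ξ).le
        · exact h1.trans (norm_pow_le_besselSymbol j ξ)
    _ = besselSymbol (j + s) ξ := (besselSymbol_add _ _ _).symm
    _ ≤ besselSymbol t ξ := by
        unfold besselSymbol
        gcongr
        simp

variable [FiniteDimensional ℝ E] [MeasurableSpace E] [BorelSpace E]

theorem besselSymbol_memLp_two {s : ℝ} (hs : Module.finrank ℝ E < 2 * s) :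
    MemLp (besselSymbol (-s) : E → ℝ) 2 volume := by
  rw [memLp_two_iff_integrable_sq
    (besselSymbol_hasTemperateGrowth _).1.continuous.aestronglyMeasurable]
  refine (integrable_rpow_neg_one_add_norm_sq hs).congr (Filter.Eventually.of_forall fun ξ => ?_)
  simp only [besselSymbol]
  rw [← Real.rpow_mul_natCast (by positivity)]
  congr 1
  push_cast
  ring

variable {V : Type*} [NormedAddCommGroup V] [InnerProductSpace ℂ V] [CompleteSpace V]

theorem eLpNorm_iteratedFDeriv_bessel_apply_le {ι : Type*} [Fintype ι]
    (b : OrthonormalBasis ι ℝ E) (m j : ℕ) (hj : j ≤ m) (r : Fin j → ι) (g : 𝓢(E, V)) :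
    eLpNorm (fun x => iteratedFDeriv ℝ j
      (SchwartzMap.fourierMultiplierCLM V (besselSymbol (-m : ℝ)) g) x (fun i => b (r i)))
        2 volume ≤ ENNReal.ofReal ((2 * Real.pi) ^ j * ‖g.toLp 2‖) := by
  have hσ : (besselSymbol (-m : ℝ) : E → ℝ).HasTemperateGrowth := besselSymbol_hasTemperateGrowth _
  rw [ENNReal.ofReal_mul (by positivity), SchwartzMap.ofReal_norm_toLp_two]
  refine (eLpNorm_le_mul_eLpNorm_of_ae_le_mul (c := (2 * Real.pi) ^ j)
    (g := SchwartzMap.fourierMultiplierCLM V (fun ξ => (∏ i, inner ℝ ξ (b (r i))) *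
      besselSymbol (-m : ℝ) ξ) g)
    (Filter.Eventually.of_forall fun x => ?_) 2).trans ?_
  · rw [SchwartzMap.iteratedFDeriv_fourierMultiplierCLM_apply hσ, norm_smul]
    simp [abs_of_pos Real.pi_pos]
  · gcongr
    refine (SchwartzMap.eLpNorm_fourierMultiplierCLM_le
      ((Function.HasTemperateGrowth.prod_inner _).mul hσ) (C := 1) (fun ξ => ?_) g).trans
      (by simp)
    refine (abs_prod_inner_mul_besselSymbol_le b r (t := 0) ?_ ξ).trans_eq
      (besselSymbol_zero ξ)
    have : (j : ℝ) ≤ m := mod_cast hj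
    linarith

theorem eLpNorm_iteratedFDeriv_le_sum {W ι : Type*} [NormedAddCommGroup W] [NormedSpace ℝ W]
    [Fintype ι] [DecidableEq ι] (b : OrthonormalBasis ι ℝ E) {j : ℕ} {h : E → W}
    (hh : ContDiff ℝ ∞ h) :
    eLpNorm (fun x => iteratedFDeriv ℝ j h x) 2 volume ≤
      ∑ r : Fin j → ι, eLpNorm (fun x => iteratedFDeriv ℝ j h x (fun i => b (r i))) 2 volume := by
  have hc : Continuous (fun x => iteratedFDeriv ℝ j h x) :=
    hh.continuous_iteratedFDeriv (mod_cast le_top)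
  have hc' : ∀ r : Fin j → ι, Continuous fun x => iteratedFDeriv ℝ j h x (fun i => b (r i)) :=
    fun r => (ContinuousMultilinearMap.apply ℝ (fun _ : Fin j => E) W
      (fun i => b (r i))).continuous.comp hc
  refine (eLpNorm_mono_real
    fun x => ContinuousMultilinearMap.norm_le_sum_orthonormalBasis b _).trans ?_
  refine (le_of_eq ?_).trans ((eLpNorm_sum_le
    (f := fun (r : Fin j → ι) x => ‖iteratedFDeriv ℝ j h x (fun i => b (r i))‖)
    (s := Finset.univ) (fun r _ => (hc' r).norm.aestronglyMeasurable) one_le_two).trans_eq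
    (Finset.sum_congr rfl fun r _ => eLpNorm_norm _))
  congr 1
  ext x
  simp

theorem exists_eLpNorm_iteratedFDeriv_bessel_le (m j : ℕ) (hj : j ≤ m) :
    ∃ C : ℝ, 0 ≤ C ∧ ∀ g : 𝓢(E, V),
      eLpNorm (fun x => iteratedFDeriv ℝ j
        (SchwartzMap.fourierMultiplierCLM V (besselSymbol (-m : ℝ)) g) x) 2 volume ≤
        ENNReal.ofReal (C * ‖g.toLp 2‖) := by
  refine ⟨∑ _r : Fin j → Fin (Module.finrank ℝ E), (2 * Real.pi) ^ j, by positivity, fun g => ?_⟩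
  refine (eLpNorm_iteratedFDeriv_le_sum (stdOrthonormalBasis ℝ E) (SchwartzMap.smooth _ _)).trans ?_
  rw [Finset.sum_mul, ENNReal.ofReal_sum_of_nonneg (fun _ _ => by positivity)]
  exact Finset.sum_le_sum fun r _ => eLpNorm_iteratedFDeriv_bessel_apply_le _ m j hj r g

theorem exists_norm_iteratedFDeriv_bessel_le (hE : Module.finrank ℝ E ≤ 3) (m j : ℕ)
    (hj : j + 2 ≤ m) :
    ∃ C : ℝ, 0 ≤ C ∧ ∀ (g : 𝓢(E, V)) (x : E),
      ‖iteratedFDeriv ℝ j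
        (SchwartzMap.fourierMultiplierCLM V (besselSymbol (-m : ℝ)) g) x‖ ≤ C * ‖g.toLp 2‖ := by
  classical
  let b := stdOrthonormalBasis ℝ E
  let ι := Fin (Module.finrank ℝ E)
  have hσ : (besselSymbol (-m : ℝ) : E → ℝ).HasTemperateGrowth := besselSymbol_hasTemperateGrowth _
  -- The dimension restriction enters here: square integrability of the symbol of order `-2` needs
  -- dimension below `4`.
  have hL : MemLp (besselSymbol (-2 : ℝ) : E → ℝ) 2 volume := by
    refine besselSymbol_memLp_two ?_
    have : (Module.finrank ℝ E : ℝ) ≤ 3 := mod_cast hE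
    linarith
  set S := eLpNorm (besselSymbol (-2 : ℝ) : E → ℝ) 2 volume
  refine ⟨∑ _r : Fin j → ι, (2 * Real.pi) ^ j * S.toReal, by positivity, fun g x => ?_⟩
  refine (ContinuousMultilinearMap.norm_le_sum_orthonormalBasis b _).trans ?_
  rw [Finset.sum_mul]
  refine Finset.sum_le_sum fun r _ => ?_
  rw [SchwartzMap.iteratedFDeriv_fourierMultiplierCLM_apply hσ, norm_smul]
  have : ‖(2 * Real.pi * Complex.I : ℂ) ^ j‖ = (2 * Real.pi) ^ j := by
    simp [abs_of_pos Real.pi_pos]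
  rw [this, mul_assoc]
  gcongr
  have h1 := SchwartzMap.enorm_fourierMultiplierCLM_apply_le
    ((Function.HasTemperateGrowth.prod_inner (fun i => b (r i))).mul hσ) g x
  have h2 : eLpNorm ((fun ξ : E => ∏ i, inner ℝ ξ (b (r i))) * besselSymbol (-m : ℝ)) 2 volume
      ≤ S := by
    refine eLpNorm_mono_real fun ξ => ?_
    refine abs_prod_inner_mul_besselSymbol_le b r ?_ ξ
    have : (j : ℝ) + 2 ≤ m := mod_cast hj
    linarith
  have h3 := h1.trans (mul_le_mul_left h2 _)
  rw [← SchwartzMap.ofReal_norm_toLp_two] at h3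
  have h4 := ENNReal.toReal_mono (ENNReal.mul_ne_top hL.2.ne ENNReal.ofReal_ne_top) h3
  rw [ENNReal.toReal_mul, ENNReal.toReal_ofReal (norm_nonneg _), toReal_enorm] at h4
  exact h4

end Bessel

/-! ### The `H^m` norm is controlled by `L²` norms of the function and its top derivative. -/

section TopOrder

variable {E : Type*} [NormedAddCommGroup E] [InnerProductSpace ℝ E]

/-- The symbol is at most `(1 + ∑ |ξ_i|)^(m+1)`, and the power mean inequality removes all cross
terms, so that only pure derivatives have to be controlled. -/
theorem besselSymbol_le_mul_one_add_sum {ι : Type*} [Fintype ι] (b : OrthonormalBasis ι ℝ E)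
    (m : ℕ) (ξ : E) :
    besselSymbol (m + 1 : ℕ) ξ ≤
      ((Fintype.card ι + 1 : ℕ) : ℝ) ^ m * (1 + ∑ i, |inner ℝ ξ (b i)| ^ (m + 1)) := by
  have h1 : ‖ξ‖ ≤ ∑ i, |inner ℝ ξ (b i)| := by
    conv_lhs => rw [← b.sum_repr' ξ]
    refine (norm_sum_le _ _).trans (Finset.sum_le_sum fun i _ => ?_)
    rw [norm_smul, b.norm_eq_one, mul_one, Real.norm_eq_abs, real_inner_comm]
  have h2 : besselSymbol (m + 1 : ℕ) ξ ≤ (1 + ∑ i, |inner ℝ ξ (b i)|) ^ (m + 1) := by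
    have h3 : (1 + ‖ξ‖ ^ 2) ^ (1 / 2 : ℝ) ≤ 1 + ‖ξ‖ := by
      rw [← Real.sqrt_eq_rpow]
      refine Real.sqrt_le_iff.2 ⟨by positivity, ?_⟩
      nlinarith [norm_nonneg ξ]
    calc besselSymbol (m + 1 : ℕ) ξ = ((1 + ‖ξ‖ ^ 2) ^ (1 / 2 : ℝ)) ^ (m + 1) := by
          rw [besselSymbol, ← Real.rpow_mul_natCast (by positivity)]
          ring_nf
      _ ≤ _ := by
          gcongr
          linarith
  refine h2.trans ?_
  -- `none` indexes the summand `1`.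
  have h4 := pow_sum_div_card_le_sum_pow (s := (Finset.univ : Finset (Option ι)))
    (f := fun o => o.elim 1 fun i => |inner ℝ ξ (b i)|) (fun o _ => by cases o <;> simp) m
  simp only [Fintype.sum_option, Option.elim_none, Option.elim_some, one_pow, Finset.card_univ,
    Fintype.card_option] at h4
  rw [div_le_iff₀ (by positivity)] at h4
  linarith

variable [FiniteDimensional ℝ E] [MeasurableSpace E] [BorelSpace E]
  {V : Type*} [NormedAddCommGroup V] [InnerProductSpace ℂ V] [CompleteSpace V]

theorem eLpNorm_fourierMultiplierCLM_inner_pow_le (e : E) (he : ‖e‖ = 1) (m : ℕ) (f : 𝓢(E, V)) :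
    eLpNorm (SchwartzMap.fourierMultiplierCLM V (fun ξ : E => inner ℝ ξ e ^ m) f) 2 volume ≤
      eLpNorm (fun x => iteratedFDeriv ℝ m f x) 2 volume := by
  refine eLpNorm_mono fun x => ?_
  have h := SchwartzMap.iteratedFDeriv_fourierMultiplierCLM_apply
    (Function.HasTemperateGrowth.const (1 : ℝ)) f (fun _ : Fin m => e) x
  simp only [SchwartzMap.fourierMultiplierCLM_const, Finset.prod_const, Finset.card_univ,
    Fintype.card_fin, mul_one, one_smul, ContinuousLinearMap.id_apply] at h
  have h2 := (iteratedFDeriv ℝ m f x).le_opNorm (fun _ => e)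
  rw [h, norm_smul] at h2
  simp only [he, Finset.prod_const_one, mul_one] at h2
  -- The factor `(2π)^m` produced by differentiation is at least `1` and is dropped.
  refine le_trans (le_mul_of_one_le_left (norm_nonneg _) ?_) h2
  rw [norm_pow]
  refine one_le_pow₀ ?_
  simp only [norm_mul, Complex.norm_ofNat, Complex.norm_real, Complex.norm_I, mul_one,
    Real.norm_eq_abs, abs_of_pos Real.pi_pos]
  linarith [Real.pi_gt_three]

theorem exists_eLpNorm_bessel_le (m : ℕ) :
    ∃ C : ℝ, 0 ≤ C ∧ ∀ f : 𝓢(E, V),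
      eLpNorm (SchwartzMap.fourierMultiplierCLM V (besselSymbol ((m + 1 : ℕ) : ℝ)) f) 2 volume ≤
        ENNReal.ofReal C * (eLpNorm f 2 volume +
          eLpNorm (fun x => iteratedFDeriv ℝ (m + 1) f x) 2 volume) := by
  let b := stdOrthonormalBasis ℝ E
  set d := Module.finrank ℝ E
  -- The power comes from the power mean inequality; the last `d + 1` absorbs the `d` copies of the
  -- derivative norm, one per coordinate.
  refine ⟨(d + 1) ^ m * (d + 1), by positivity, fun f => ?_⟩
  have hσ : (besselSymbol ((m + 1 : ℕ) : ℝ) : E → ℝ).HasTemperateGrowth :=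
    besselSymbol_hasTemperateGrowth _
  let D : Fin d → 𝓢(E, V) := fun i =>
    SchwartzMap.fourierMultiplierCLM V (fun ξ : E => inner ℝ ξ (b i) ^ (m + 1)) f
  have hD : ∀ i ξ, ‖(𝓕 (D i) : 𝓢(E, V)) ξ‖ =
      |inner ℝ ξ (b i)| ^ (m + 1) * ‖(𝓕 f : 𝓢(E, V)) ξ‖ := by
    intro i ξ
    rw [SchwartzMap.fourier_fourierMultiplierCLM (by fun_prop), norm_smul]
    simp
  rw [← SchwartzMap.eLpNorm_fourier_two]
  set G : E → ℝ := fun ξ => ‖(𝓕 f : 𝓢(E, V)) ξ‖ + ∑ i, ‖(𝓕 (D i) : 𝓢(E, V)) ξ‖ with hG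
  have hm : ∀ u : 𝓢(E, V), AEStronglyMeasurable (fun ξ => ‖u ξ‖) volume :=
    fun u => u.continuous.norm.aestronglyMeasurable
  have h1 : eLpNorm (𝓕 (SchwartzMap.fourierMultiplierCLM V (besselSymbol ((m + 1 : ℕ) : ℝ)) f) :
      𝓢(E, V)) 2 volume ≤ ENNReal.ofReal ((d + 1) ^ m) * eLpNorm G 2 volume := by
    refine eLpNorm_le_mul_eLpNorm_of_ae_le_mul (Filter.Eventually.of_forall fun ξ => ?_) 2
    rw [SchwartzMap.fourier_fourierMultiplierCLM hσ, norm_smul, Real.norm_eq_abs,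
      abs_of_pos (besselSymbol_pos _ _), Real.norm_of_nonneg (by positivity)]
    refine (mul_le_mul_of_nonneg_right (besselSymbol_le_mul_one_add_sum b m ξ)
      (norm_nonneg _)).trans_eq ?_
    simp only [hG, hD, Fintype.card_fin, ← Finset.sum_mul]
    push_cast
    ring
  have h2 : eLpNorm G 2 volume ≤ eLpNorm f 2 volume +
      ∑ _i : Fin d, eLpNorm (fun x => iteratedFDeriv ℝ (m + 1) f x) 2 volume := by
    have hs : AEStronglyMeasurable (∑ i, fun ξ => ‖(𝓕 (D i) : 𝓢(E, V)) ξ‖) volume :=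
      Finset.aestronglyMeasurable_sum _ fun i _ => hm _
    have hG' : G = (fun ξ => ‖(𝓕 f : 𝓢(E, V)) ξ‖) + ∑ i, fun ξ => ‖(𝓕 (D i) : 𝓢(E, V)) ξ‖ := by
      ext ξ
      simp [hG]
    rw [hG']
    refine (eLpNorm_add_le (hm _) hs one_le_two).trans ?_
    gcongr
    · rw [eLpNorm_norm, SchwartzMap.eLpNorm_fourier_two]
    · refine (eLpNorm_sum_le (fun i _ => hm _) one_le_two).trans (Finset.sum_le_sum fun i _ => ?_)
      rw [eLpNorm_norm, SchwartzMap.eLpNorm_fourier_two]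
      exact eLpNorm_fourierMultiplierCLM_inner_pow_le _ (b.norm_eq_one i) _ _
  refine h1.trans ((mul_le_mul_right h2 _).trans ?_)
  rw [ENNReal.ofReal_mul (by positivity), mul_assoc]
  gcongr
  rw [Finset.sum_const, Finset.card_univ, Fintype.card_fin, nsmul_eq_mul, mul_add]
  have h3 : ENNReal.ofReal ((d : ℝ) + 1) = (d : ℝ≥0∞) + 1 := by
    rw [ENNReal.ofReal_add (by positivity) zero_le_one]
    simp
  rw [h3]
  gcongr
  · exact le_mul_of_one_le_left zero_le le_add_self
  · exact le_self_add

end TopOrder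

/-! ### A Gagliardo–Nirenberg inequality: first derivatives in `L⁴`. -/

section GagliardoNirenberg

variable {E : Type*} [NormedAddCommGroup E] [InnerProductSpace ℝ E]
  [FiniteDimensional ℝ E] [MeasurableSpace E] [BorelSpace E]

theorem eLpNorm_two_le_of_integral_sq_le {a b : E → ℝ} (ha : MemLp a 2 volume)
    (hb : MemLp b 2 volume) {c : ℝ} (hc : 0 ≤ c) (h : ∫ x, a x ^ 2 ≤ c ^ 2 * ∫ x, b x ^ 2) :
    eLpNorm a 2 volume ≤ ENNReal.ofReal c * eLpNorm b 2 volume := by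
  rw [ha.eLpNorm_eq_integral_rpow_norm two_ne_zero ENNReal.ofNat_ne_top,
    hb.eLpNorm_eq_integral_rpow_norm two_ne_zero ENNReal.ofNat_ne_top, ← ENNReal.ofReal_mul hc]
  refine ENNReal.ofReal_le_ofReal ?_
  simp only [ENNReal.toReal_ofNat, Real.rpow_ofNat, Real.norm_eq_abs, sq_abs]
  rw [← one_div, ← Real.sqrt_eq_rpow, ← Real.sqrt_eq_rpow]
  refine (Real.sqrt_le_sqrt h).trans_eq ?_
  rw [Real.sqrt_mul (sq_nonneg c), Real.sqrt_sq hc]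

/-- With `q = ∂w` and `s = ∂q`, integration by parts gives `∫ q⁴ = -3 ∫ q² s w`. By Young's
inequality this is at most `½ ∫ q⁴ + (9/2) S² ∫ s²`, and the first term is absorbed on the left. -/
theorem SchwartzMap.integral_lineDerivOp_pow_four_le (w : 𝓢(E, ℝ)) (e : E) {S : ℝ}
    (hS : ∀ x, |w x| ≤ S) :
    ∫ x, ((∂_{e} w) x ^ 2) ^ 2 ≤ (3 * S) ^ 2 * ∫ x, (∂_{e} (∂_{e} w)) x ^ 2 := by
  set q := ∂_{e} w
  set s := ∂_{e} q
  have hS0 : 0 ≤ S := (abs_nonneg _).trans (hS 0)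
  have hq : (q : E → ℝ).HasTemperateGrowth := q.hasTemperateGrowth
  let c : 𝓢(E, ℝ) := SchwartzMap.smulLeftCLM ℝ (fun x => q x ^ 2) q
  have hc : ⇑c = fun x => q x ^ 3 := by
    ext x
    simp only [c, SchwartzMap.smulLeftCLM_apply_apply (hq.fun_pow 2), smul_eq_mul]
    ring
  have hc' : ∀ x, (∂_{e} c) x = 3 * q x ^ 2 * s x := by
    intro x
    rw [SchwartzMap.lineDerivOp_apply_eq_fderiv, hc,
      (((q.differentiableAt (x := x)).hasFDerivAt).pow 3).fderiv]
    simp [s, SchwartzMap.lineDerivOp_apply_eq_fderiv]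
  have hibp := SchwartzMap.integral_mul_lineDerivOp_right_eq_neg_left (μ := volume) c w e
  -- The products are realised as Schwartz functions to obtain their integrability.
  let q4 : 𝓢(E, ℝ) := SchwartzMap.smulLeftCLM ℝ (fun x => q x ^ 3) q
  have hq4 : ⇑q4 = fun x => (q x ^ 2) ^ 2 := by
    ext x
    simp only [q4, SchwartzMap.smulLeftCLM_apply_apply (hq.fun_pow 3), smul_eq_mul]
    ring
  let s2 : 𝓢(E, ℝ) := SchwartzMap.smulLeftCLM ℝ s s
  have hs2 : ⇑s2 = fun x => s x ^ 2 := by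
    ext x
    simp only [s2, SchwartzMap.smulLeftCLM_apply_apply s.hasTemperateGrowth, smul_eq_mul]
    ring
  have i4 : Integrable (fun x => (q x ^ 2) ^ 2) := hq4 ▸ q4.integrable
  have i2 : Integrable (fun x => s x ^ 2) := hs2 ▸ s2.integrable
  let dc : 𝓢(E, ℝ) := ∂_{e} c
  have hdc : ∀ x, dc x = 3 * q x ^ 2 * s x := hc'
  let p : 𝓢(E, ℝ) := SchwartzMap.smulLeftCLM ℝ dc w
  have hp : ⇑p = fun x => 3 * q x ^ 2 * s x * w x := by
    ext x
    simp only [p, SchwartzMap.smulLeftCLM_apply_apply dc.hasTemperateGrowth, smul_eq_mul, hdc]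
  have iw : Integrable (fun x => 3 * q x ^ 2 * s x * w x) := hp ▸ p.integrable
  have h1 : ∫ x, (q x ^ 2) ^ 2 = - ∫ x, 3 * q x ^ 2 * s x * w x := by
    simp only [hc', hc] at hibp
    rw [← hibp]
    refine integral_congr_ae (Filter.Eventually.of_forall fun x => ?_)
    simp only [q]
    ring
  have h2 : - ∫ x, 3 * q x ^ 2 * s x * w x ≤
      ∫ x, ((1 / 2) * (q x ^ 2) ^ 2 + (9 / 2 * S ^ 2) * s x ^ 2) := by
    rw [← integral_neg]
    refine integral_mono iw.neg ((i4.const_mul _).add (i2.const_mul _)) fun x => ?_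
    have hw : (s x * w x) ^ 2 ≤ S ^ 2 * s x ^ 2 := by
      rw [mul_pow, mul_comm]
      exact mul_le_mul_of_nonneg_right
        (sq_le_sq' (neg_le_of_abs_le (hS x)) (le_of_abs_le (hS x))) (sq_nonneg _)
    simp only
    nlinarith [sq_nonneg (q x ^ 2 + 3 * (s x * w x))]
  rw [integral_add (i4.const_mul _) (i2.const_mul _), integral_const_mul, integral_const_mul] at h2
  nlinarith

theorem SchwartzMap.eLpNorm_fderiv_apply_sq_le (w : 𝓢(E, ℝ)) (e : E) (he : ‖e‖ = 1) {S : ℝ}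
    (hS : ∀ x, |w x| ≤ S) :
    eLpNorm (fun x => (fderiv ℝ w x e) ^ 2) 2 volume ≤
      ENNReal.ofReal (3 * S) * eLpNorm (fun x => iteratedFDeriv ℝ 2 w x) 2 volume := by
  have hS0 : 0 ≤ S := (abs_nonneg _).trans (hS 0)
  let q : 𝓢(E, ℝ) := ∂_{e} w
  let s : 𝓢(E, ℝ) := ∂_{e} q
  let q2 : 𝓢(E, ℝ) := SchwartzMap.smulLeftCLM ℝ q q
  have hq2 : ⇑q2 = fun x => q x ^ 2 := by
    ext x
    simp only [q2, SchwartzMap.smulLeftCLM_apply_apply q.hasTemperateGrowth, smul_eq_mul]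
    ring
  have h := eLpNorm_two_le_of_integral_sq_le (hq2 ▸ q2.memLp 2) (s.memLp 2)
    (mul_nonneg zero_le_three hS0) (w.integral_lineDerivOp_pow_four_le e hS)
  refine h.trans ?_
  gcongr
  refine eLpNorm_mono fun x => ?_
  have h1 := SchwartzMap.iteratedLineDerivOp_eq_iteratedFDeriv (m := fun _ : Fin 2 => e)
    (f := w) (x := x)
  change ‖(∂^{fun _ : Fin 2 => e} w) x‖ ≤ _
  rw [h1]
  refine ((iteratedFDeriv ℝ 2 w x).le_opNorm (fun _ => e)).trans ?_
  simp [he]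

end GagliardoNirenberg

/-! ### Smooth approximation of a homogeneous function, with scale-invariant bounds. -/

section Regularization

open scoped Topology

variable {Y W : Type*} [NormedAddCommGroup Y] [NormedSpace ℝ Y]
  [NormedAddCommGroup W] [NormedSpace ℝ W]

/-- Differentiate the homogeneity relation `j` times and cancel the `t^j` from the chain rule. A
local hypothesis is essential, since the cut-off function is homogeneous only away from the origin.
-/
theorem norm_iteratedFDeriv_smul_of_eventuallyEq {H : Y → W} (hH : ContDiff ℝ ∞ H) {m j : ℕ}
    (hj : j ≤ m) {t : ℝ} (ht : 0 < t) {y : Y} (h : ∀ᶠ z in 𝓝 y, H (t • z) = t ^ m • H z) :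
    ‖iteratedFDeriv ℝ j H (t • y)‖ = t ^ (m - j) * ‖iteratedFDeriv ℝ j H y‖ := by
  have h1 : iteratedFDeriv ℝ j (fun z => H (t • z)) y = iteratedFDeriv ℝ j (t ^ m • H) y :=
    (Filter.EventuallyEq.iteratedFDeriv ℝ (f₁ := fun z => H (t • z)) h j).self_of_nhds
  have hj' : ContDiff ℝ j H := hH.of_le (mod_cast le_top)
  rw [iteratedFDeriv_comp_const_smul t hj', iteratedFDeriv_const_smul_apply hj'.contDiffAt] at h1
  have h2 := congrArg norm h1
  simp only [norm_smul, norm_pow, Real.norm_of_nonneg ht.le] at h2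
  have h3 : t ^ m = t ^ j * t ^ (m - j) := by rw [← pow_add, Nat.add_sub_cancel' hj]
  rw [h3, mul_assoc] at h2
  exact mul_left_cancel₀ (pow_pos ht j).ne' h2

/-- Three regions: near the origin `H` vanishes, on `1/2 ≤ ‖y‖ ≤ 2` compactness suffices, and beyond
that homogeneity scales back to the sphere of radius `2`. That sphere lies in the open set `‖y‖ >
1`, so the relation holds in a neighbourhood of each of its points. -/
theorem exists_norm_iteratedFDeriv_le_mul_norm_pow [FiniteDimensional ℝ Y] {H : Y → W}
    (hH : ContDiff ℝ ∞ H) (m : ℕ) (h0 : ∀ y, ‖y‖ < 1 / 2 → H y = 0)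
    (h1 : ∀ t : ℝ, 1 ≤ t → ∀ y, 1 < ‖y‖ → H (t • y) = t ^ m • H y) :
    ∃ C : ℝ, 0 ≤ C ∧ ∀ j ≤ m, ∀ y, ‖iteratedFDeriv ℝ j H y‖ ≤ C * ‖y‖ ^ (m - j) := by
  have hB : ∀ j : ℕ, ∃ B : ℝ, ∀ y ∈ Metric.closedBall (0 : Y) 2, ‖iteratedFDeriv ℝ j H y‖ ≤ B :=
    fun j => (isCompact_closedBall (0 : Y) 2).exists_bound_of_continuousOn
      (hH.continuous_iteratedFDeriv (m := j) (mod_cast le_top)).continuousOn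
  choose B hB using hB
  have hB0 : ∀ j, 0 ≤ B j := fun j => (norm_nonneg _).trans (hB j 0 (by simp))
  refine ⟨∑ j ∈ Finset.range (m + 1), 2 ^ m * B j, Finset.sum_nonneg fun j _ => by
    have := hB0 j; positivity, fun j hj y => ?_⟩
  have hle : 2 ^ m * B j ≤ ∑ j ∈ Finset.range (m + 1), 2 ^ m * B j :=
    Finset.single_le_sum (f := fun j => 2 ^ m * B j) (fun j _ => by have := hB0 j; positivity)
      (Finset.mem_range.2 (Nat.lt_succ_of_le hj))
  refine le_trans ?_ (mul_le_mul_of_nonneg_right hle (by positivity))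
  have h2m : (2 : ℝ) ^ (m - j) ≤ 2 ^ m := pow_le_pow_right₀ one_le_two (Nat.sub_le _ _)
  rcases lt_or_ge ‖y‖ (1 / 2) with hy | hy
  · have : H =ᶠ[𝓝 y] fun _ => 0 := by
      filter_upwards [(isOpen_lt continuous_norm continuous_const).mem_nhds hy] with z hz
      exact h0 z hz
    rw [(this.iteratedFDeriv ℝ j).self_of_nhds]
    have h3 : iteratedFDeriv ℝ j (fun _ : Y => (0 : W)) y = 0 := by
      rw [iteratedFDeriv_fun_zero]; rfl
    rw [h3, norm_zero]
    have := hB0 j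
    positivity
  rcases le_or_gt ‖y‖ 2 with hy2 | hy2
  · calc ‖iteratedFDeriv ℝ j H y‖ ≤ B j := hB j y (by simpa using hy2)
      _ = 2 ^ (m - j) * B j * (1 / 2) ^ (m - j) := by
        rw [mul_right_comm, ← mul_pow]; norm_num
      _ ≤ 2 ^ m * B j * ‖y‖ ^ (m - j) := by
        have := hB0 j
        gcongr
  · have ht : 1 ≤ ‖y‖ / 2 := by linarith
    have ht0 : 0 < ‖y‖ / 2 := by linarith
    set z := (‖y‖ / 2)⁻¹ • y with hz
    have hyz : y = (‖y‖ / 2) • z := by rw [hz, smul_inv_smul₀ ht0.ne']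
    have hzn : ‖z‖ = 2 := by
      rw [hz, norm_smul, norm_inv, Real.norm_of_nonneg ht0.le]
      field_simp
    have h3 := norm_iteratedFDeriv_smul_of_eventuallyEq hH hj ht0 (y := z) (by
      have h4 : (1 : ℝ) < ‖z‖ := by rw [hzn]; norm_num
      filter_upwards [(isOpen_lt continuous_const continuous_norm).mem_nhds h4] with w hw
      exact h1 _ ht w hw)
    rw [← hyz] at h3
    rw [h3]
    have := hB0 j
    calc (‖y‖ / 2) ^ (m - j) * ‖iteratedFDeriv ℝ j H z‖ ≤ ‖y‖ ^ (m - j) * B j := by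
          gcongr
          · linarith
          · exact hB j z (by simp [hzn])
      _ ≤ 2 ^ m * B j * ‖y‖ ^ (m - j) := by
          rw [mul_comm, mul_assoc]
          exact le_mul_of_one_le_left (by positivity) (one_le_pow₀ one_le_two)

/-- Cut off once at scale `1` to get `H`, then take `ε^m H(y/ε)`. The bounds are invariant because
`ε^m ε^(-j) ε^(-(m-j)) = 1`; this makes `C` independent of `ε`. -/
theorem exists_smooth_approx_of_homogeneous [FiniteDimensional ℝ Y] {F : Y → W}
    (hF : ContDiffOn ℝ ∞ F {0}ᶜ) (m : ℕ)
    (hhom : ∀ t : ℝ, 0 ≤ t → ∀ y, F (t • y) = t ^ m • F y) :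
    ∃ C : ℝ, 0 ≤ C ∧ ∀ ε : ℝ, 0 < ε → ∃ G : Y → W, ContDiff ℝ ∞ G ∧
      (∀ j ≤ m, ∀ y, ‖iteratedFDeriv ℝ j G y‖ ≤ C * ‖y‖ ^ (m - j)) ∧
      (∀ y, ‖y‖ < ε / 2 → G y = 0) ∧ ∀ y, ε ≤ ‖y‖ → G y = F y := by
  let χ : ContDiffBump (0 : Y) := ⟨1 / 2, 1, by norm_num, by norm_num⟩
  set H : Y → W := fun y => (1 - χ y) • F y with hHdef
  have h0 : ∀ y, ‖y‖ < 1 / 2 → H y = 0 := by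
    intro y hy
    have : χ y = 1 := χ.one_of_mem_closedBall (by simpa [χ] using hy.le)
    simp [hHdef, this]
  have hHF : ∀ y, 1 ≤ ‖y‖ → H y = F y := by
    intro y hy
    have : χ y = 0 := χ.zero_of_le_dist (by simpa using hy)
    simp [hHdef, this]
  have hH : ContDiff ℝ ∞ H := by
    rw [contDiff_iff_contDiffAt]
    intro y
    by_cases hy : y = 0
    · have : H =ᶠ[𝓝 y] fun _ => 0 := by
        have hy' : ‖y‖ < 1 / 2 := by simp [hy]
        filter_upwards [(isOpen_lt continuous_norm continuous_const).mem_nhds hy'] with z hz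
        exact h0 z hz
      exact contDiffAt_const.congr_of_eventuallyEq this
    · exact (contDiffAt_const.sub χ.contDiff.contDiffAt).smul
        (hF.contDiffAt (isOpen_compl_singleton.mem_nhds hy))
  obtain ⟨C, hC0, hC⟩ := exists_norm_iteratedFDeriv_le_mul_norm_pow hH m h0 (by
    intro t ht y hy
    rw [hHF _ hy.le, hHF, hhom t (by linarith)]
    rw [norm_smul, Real.norm_of_nonneg (by linarith)]
    nlinarith)
  refine ⟨C, hC0, fun ε hε => ⟨fun y => ε ^ m • H (ε⁻¹ • y), ?_, ?_, ?_, ?_⟩⟩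
  · exact contDiff_const.smul (hH.comp (contDiff_const_smul _))
  · intro j hj y
    have hj' : ContDiff ℝ j H := hH.of_le (mod_cast le_top)
    have h1 : iteratedFDeriv ℝ j (fun y => ε ^ m • H (ε⁻¹ • y)) y =
        ε ^ m • ε⁻¹ ^ j • iteratedFDeriv ℝ j H (ε⁻¹ • y) := by
      have h2 : ContDiff ℝ j fun y => H (ε⁻¹ • y) := hj'.comp (contDiff_const_smul _)
      rw [iteratedFDeriv_const_smul_apply' h2.contDiffAt, iteratedFDeriv_comp_const_smul _ hj']
    rw [h1, norm_smul, norm_smul, norm_pow, norm_pow, norm_inv, Real.norm_of_nonneg hε.le]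
    have h2 := hC j hj (ε⁻¹ • y)
    rw [norm_smul, norm_inv, Real.norm_of_nonneg hε.le] at h2
    calc _ ≤ ε ^ m * (ε⁻¹ ^ j * (C * (ε⁻¹ * ‖y‖) ^ (m - j))) := by gcongr
      _ = C * ‖y‖ ^ (m - j) := by
        have h3 : ε⁻¹ ^ j * ε⁻¹ ^ (m - j) * ε ^ m = 1 := by
          rw [← pow_add, Nat.add_sub_cancel' hj, ← mul_pow, inv_mul_cancel₀ hε.ne', one_pow]
        rw [mul_pow]
        linear_combination (C * ‖y‖ ^ (m - j)) * h3
  · intro y hy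
    simp only
    rw [h0, smul_zero]
    rw [norm_smul, norm_inv, Real.norm_of_nonneg hε.le, inv_mul_lt_iff₀ hε]
    linarith
  · intro y hy
    simp only
    rw [hHF, ← hhom _ hε.le, smul_inv_smul₀ hε.ne']
    rw [norm_smul, norm_inv, Real.norm_of_nonneg hε.le, le_inv_mul_iff₀ hε]
    linarith

theorem norm_sub_le_of_norm_fderiv_le_norm_pow {G : Y → W} (hG : ContDiff ℝ ∞ G) {C : ℝ}
    (hC0 : 0 ≤ C) {k : ℕ} (hC : ∀ y, ‖fderiv ℝ G y‖ ≤ C * ‖y‖ ^ k) (a b : Y) :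
    ‖G a - G b‖ ≤ C * max ‖a‖ ‖b‖ ^ k * ‖a - b‖ := by
  refine (convex_closedBall (0 : Y) (max ‖a‖ ‖b‖)).norm_image_sub_le_of_norm_fderiv_le
    (𝕜 := ℝ) (fun x _ => (hG.differentiable (by simp)).differentiableAt) (fun x hx => ?_) ?_ ?_
  · refine (hC x).trans ?_
    have : ‖x‖ ≤ max ‖a‖ ‖b‖ := by simpa using hx
    gcongr
  · simp
  · simp

end Regularization

/-! ### Faà di Bruno's formula and the estimate of each of its terms. -/

section Composition

theorem OrderedFinpartition.sum_partSize {m : ℕ} (c : OrderedFinpartition m) :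
    ∑ i, c.partSize i = m := by
  simpa using c.sum_sigma_eq_sum (fun _ : Fin m => (1 : ℕ))

/-- Take a largest part for `i₀`. A second part of size at least `m - 1` forces `2(m - 1) ≤ m`,
which leaves only `2 = 1 + 1`. -/
theorem OrderedFinpartition.exists_forall_partSize_add_two_le {m : ℕ} (hm : 1 ≤ m)
    (c : OrderedFinpartition m) :
    (∃ i₀, ∀ i ≠ i₀, c.partSize i + 2 ≤ m) ∨
      m = 2 ∧ c.length = 2 ∧ ∀ i, c.partSize i = 1 := by
  have : Nonempty (Fin c.length) := ⟨⟨0, c.length_pos hm⟩⟩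
  obtain ⟨i₀, hi₀⟩ := Finite.exists_max c.partSize
  by_cases h : ∀ i ≠ i₀, c.partSize i + 2 ≤ m
  · exact Or.inl ⟨i₀, h⟩
  right
  push Not at h
  obtain ⟨i, hi, hlt⟩ := h
  have hpair : c.partSize i + c.partSize i₀ ≤ m := by
    conv_rhs => rw [← c.sum_partSize]
    rw [← Finset.sum_pair hi]
    exact Finset.sum_le_sum_of_subset (Finset.subset_univ _)
  have h1 := hi₀ i
  have h2 := c.partSize_pos i
  have hm2 : m = 2 := by omega
  have h3 : ∀ k, c.partSize k = 1 := fun k => by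
    have := hi₀ k
    have := c.partSize_pos k
    omega
  refine ⟨hm2, ?_, h3⟩
  have := c.sum_partSize
  simp only [h3, Finset.sum_const, Finset.card_univ, Fintype.card_fin, smul_eq_mul,
    mul_one] at this
  omega

variable {E Y W : Type*} [NormedAddCommGroup E] [NormedSpace ℝ E]
  [NormedAddCommGroup Y] [NormedSpace ℝ Y] [NormedAddCommGroup W] [NormedSpace ℝ W]

theorem norm_iteratedFDeriv_comp_le_sum {G : Y → W} (hG : ContDiff ℝ ∞ G) {v : E → Y}
    (hv : ContDiff ℝ ∞ v) (m : ℕ) (x : E) :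
    ‖iteratedFDeriv ℝ m (G ∘ v) x‖ ≤ ∑ c : OrderedFinpartition m,
      ‖iteratedFDeriv ℝ c.length G (v x)‖ * ∏ i, ‖iteratedFDeriv ℝ (c.partSize i) v x‖ := by
  rw [iteratedFDeriv_comp (n := m) (hG.contDiffAt.of_le (mod_cast le_top))
    (hv.contDiffAt.of_le (mod_cast le_top)) le_rfl]
  exact (norm_sum_le _ _).trans
    (Finset.sum_le_sum fun c _ => c.norm_compAlongOrderedFinpartition_le _ _)

variable [MeasureSpace E]

/-- The derivatives of `v` obey the bounds which membership in a ball of radius proportional to `B`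
in the Sobolev space of order `m` provides, for `m = 1`, or for `m ≥ 2` in dimension at most `3`. -/
structure SobolevDerivBound (m : ℕ) (v : E → Y) (B : ℝ) : Prop where
  nonneg : 0 ≤ B
  contDiff : ContDiff ℝ ∞ v
  eLpNorm_le : ∀ j ≤ m, eLpNorm (fun x => iteratedFDeriv ℝ j v x) 2 volume ≤ ENNReal.ofReal B
  norm_le : ∀ j, j + 2 ≤ m → ∀ x, ‖iteratedFDeriv ℝ j v x‖ ≤ B
  eLpNorm_sq_le : m = 2 →
    eLpNorm (fun x => ‖iteratedFDeriv ℝ 1 v x‖ ^ 2) 2 volume ≤ ENNReal.ofReal (B ^ 2)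

variable {m : ℕ} {v : E → Y} {B : ℝ}

theorem SobolevDerivBound.norm_pow_le (hv : SobolevDerivBound m v B) {k : ℕ} (hk : k + 1 ≤ m)
    (x : E) : ‖v x‖ ^ k ≤ B ^ k := by
  rcases Nat.eq_zero_or_pos k with rfl | hk0
  · simp
  · have := hv.norm_le 0 (by omega) x
    rw [norm_iteratedFDeriv_zero] at this
    gcongr

/-- Sup bounds on all factors but one give `B^(m-|c|) B^(|c|-1) = B^(m-1)`, and the remaining factor
contributes `B` in `L²`. The partition `1 + 1` is covered by `eLpNorm_sq_le`. -/
theorem SobolevDerivBound.eLpNorm_partition_le (hv : SobolevDerivBound m v B) (hm : 1 ≤ m)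
    (c : OrderedFinpartition m) :
    eLpNorm (fun x => ‖v x‖ ^ (m - c.length) * ∏ i, ‖iteratedFDeriv ℝ (c.partSize i) v x‖)
      2 volume ≤ ENNReal.ofReal (B ^ m) := by
  have hB := hv.nonneg
  have hl := c.length_pos hm
  have hl' := c.length_le
  rcases c.exists_forall_partSize_add_two_le hm with ⟨i₀, hi₀⟩ | ⟨h2, hl2, h1⟩
  · have hpt : ∀ x, ‖‖v x‖ ^ (m - c.length) * ∏ i, ‖iteratedFDeriv ℝ (c.partSize i) v x‖‖ ≤
        B ^ (m - 1) * ‖iteratedFDeriv ℝ (c.partSize i₀) v x‖ := by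
      intro x
      rw [Real.norm_of_nonneg (by positivity),
        ← Finset.prod_erase_mul _ _ (Finset.mem_univ i₀), ← mul_assoc]
      refine mul_le_mul_of_nonneg_right ?_ (norm_nonneg _)
      have hp : ∏ i ∈ Finset.univ.erase i₀, ‖iteratedFDeriv ℝ (c.partSize i) v x‖ ≤
          B ^ (c.length - 1) := by
        refine (Finset.prod_le_prod (fun _ _ => norm_nonneg _) (g := fun _ => B) fun i hi =>
          hv.norm_le _ (hi₀ i (Finset.ne_of_mem_erase hi)) x).trans_eq ?_
        simp [Finset.card_erase_of_mem]
      calc _ ≤ B ^ (m - c.length) * B ^ (c.length - 1) := by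
            exact mul_le_mul (hv.norm_pow_le (by omega) x) hp
              (Finset.prod_nonneg fun _ _ => norm_nonneg _) (by positivity)
        _ = B ^ (m - 1) := by rw [← pow_add]; congr 1; omega
    refine (eLpNorm_le_mul_eLpNorm_of_ae_le_mul (Filter.Eventually.of_forall hpt) 2).trans ?_
    refine (mul_le_mul_right (hv.eLpNorm_le _ (c.partSize_le i₀)) _).trans ?_
    rw [← ENNReal.ofReal_mul (by positivity), ← pow_succ, Nat.sub_add_cancel hm]
  · subst h2
    have h3 : ∀ i x, ‖iteratedFDeriv ℝ (c.partSize i) v x‖ = ‖iteratedFDeriv ℝ 1 v x‖ :=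
      fun i x => by rw [h1]
    simp only [h3, hl2, Finset.prod_const, Finset.card_univ, Fintype.card_fin, Nat.sub_self,
      pow_zero, one_mul]
    exact hv.eLpNorm_sq_le rfl

theorem SobolevDerivBound.eLpNorm_comp_le (hv : SobolevDerivBound m v B) (hm : 1 ≤ m)
    {G : Y → W} {C : ℝ} (hC0 : 0 ≤ C)
    (hC : ∀ j ≤ m, ∀ y, ‖iteratedFDeriv ℝ j G y‖ ≤ C * ‖y‖ ^ (m - j)) :
    eLpNorm (G ∘ v) 2 volume ≤ ENNReal.ofReal (C * B ^ m) := by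
  have hB := hv.nonneg
  have hpt : ∀ x, ‖(G ∘ v) x‖ ≤ C * B ^ (m - 1) * ‖iteratedFDeriv ℝ 0 v x‖ := by
    intro x
    have h0 := hC 0 (Nat.zero_le _) (v x)
    rw [norm_iteratedFDeriv_zero, Nat.sub_zero] at h0
    have h1 := hv.norm_pow_le (k := m - 1) (by omega) x
    calc _ ≤ C * ‖v x‖ ^ m := h0
      _ = C * ‖v x‖ ^ (m - 1) * ‖v x‖ := by
        rw [mul_assoc, ← pow_succ, Nat.sub_add_cancel hm]
      _ ≤ _ := by
        rw [norm_iteratedFDeriv_zero]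
        gcongr
  refine (eLpNorm_le_mul_eLpNorm_of_ae_le_mul (Filter.Eventually.of_forall hpt) 2).trans ?_
  refine (mul_le_mul_right (hv.eLpNorm_le 0 (Nat.zero_le _)) _).trans ?_
  rw [← ENNReal.ofReal_mul (by positivity), mul_assoc, ← pow_succ, Nat.sub_add_cancel hm]

variable [OpensMeasurableSpace E] [SecondCountableTopologyEither E ℝ]

theorem SobolevDerivBound.eLpNorm_iteratedFDeriv_comp_le (hv : SobolevDerivBound m v B)
    (hm : 1 ≤ m) {G : Y → W} (hG : ContDiff ℝ ∞ G) {C : ℝ} (hC0 : 0 ≤ C)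
    (hC : ∀ j ≤ m, ∀ y, ‖iteratedFDeriv ℝ j G y‖ ≤ C * ‖y‖ ^ (m - j)) :
    eLpNorm (fun x => iteratedFDeriv ℝ m (G ∘ v) x) 2 volume ≤
      ENNReal.ofReal (Fintype.card (OrderedFinpartition m) * C * B ^ m) := by
  have hB := hv.nonneg
  let T : OrderedFinpartition m → E → ℝ := fun c x =>
    ‖v x‖ ^ (m - c.length) * ∏ i, ‖iteratedFDeriv ℝ (c.partSize i) v x‖
  have hT : ∀ c, AEStronglyMeasurable (T c) volume := by
    intro c
    have h1 : ∀ j : ℕ, Continuous fun x => ‖iteratedFDeriv ℝ j v x‖ := fun j =>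
      (hv.contDiff.continuous_iteratedFDeriv (m := j) (mod_cast le_top)).norm
    exact ((hv.contDiff.continuous.norm.pow _).mul
      (continuous_finsetProd _ fun i _ => h1 _)).aestronglyMeasurable
  have hpt : ∀ x, ‖iteratedFDeriv ℝ m (G ∘ v) x‖ ≤ C * ‖(∑ c, T c) x‖ := by
    intro x
    have hT0 : ∀ c, 0 ≤ T c x := fun c => by positivity
    rw [Finset.sum_apply, Real.norm_of_nonneg (Finset.sum_nonneg fun c _ => hT0 c), Finset.mul_sum]
    refine (norm_iteratedFDeriv_comp_le_sum hG hv.contDiff m x).trans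
      (Finset.sum_le_sum fun c _ => ?_)
    rw [← mul_assoc]
    exact mul_le_mul_of_nonneg_right (hC _ c.length_le _) (by positivity)
  refine (eLpNorm_le_mul_eLpNorm_of_ae_le_mul (Filter.Eventually.of_forall hpt) 2).trans ?_
  have hs : eLpNorm (∑ c, T c) 2 volume ≤
      ∑ _c : OrderedFinpartition m, ENNReal.ofReal (B ^ m) :=
    (eLpNorm_sum_le (fun c _ => hT c) one_le_two).trans
      (Finset.sum_le_sum fun c _ => hv.eLpNorm_partition_le hm c)
  refine (mul_le_mul_right hs _).trans_eq ?_
  rw [Finset.sum_const, Finset.card_univ, nsmul_eq_mul, ← ENNReal.ofReal_natCast,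
    ← ENNReal.ofReal_mul (by positivity), ← ENNReal.ofReal_mul hC0]
  congr 1
  ring

end Composition

/-! ### The a priori estimate for Schwartz data. -/

section APriori

variable {E : Type*} [NormedAddCommGroup E] [InnerProductSpace ℝ E]
  {V : Type*} [NormedAddCommGroup V] [InnerProductSpace ℂ V] {p : ℕ}

/-- The `L⁴` inequality is available for one scalar component and one direction at a time;
Cauchy–Schwarz for the finite sum costs the cardinality. -/
theorem norm_iteratedFDeriv_one_sq_le {ι : Type*} [Fintype ι] [DecidableEq ι]
    (b : OrthonormalBasis ι ℝ E) {v : E → EuclideanSpace ℝ (Fin p)} (hv : ContDiff ℝ ∞ v) (x : E) :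
    ‖iteratedFDeriv ℝ 1 v x‖ ^ 2 ≤ (Fintype.card ((Fin 1 → ι) × Fin p) : ℝ) *
      ∑ q : (Fin 1 → ι) × Fin p, (fderiv ℝ (fun y => v y q.2) x (b (q.1 0))) ^ 2 := by
  have h1 : ‖iteratedFDeriv ℝ 1 v x‖ ≤
      ∑ q : (Fin 1 → ι) × Fin p, |fderiv ℝ (fun y => v y q.2) x (b (q.1 0))| := by
    refine (ContinuousMultilinearMap.norm_le_sum_orthonormalBasis b _).trans ?_
    rw [Fintype.sum_prod_type]
    refine Finset.sum_le_sum fun r _ => ?_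
    rw [iteratedFDeriv_one_apply]
    have hd : DifferentiableAt ℝ v x := (hv.differentiable (by simp)).differentiableAt
    have h2 : ∀ a : Fin p, fderiv ℝ (fun y => v y a) x (b (r 0)) =
        (fderiv ℝ v x (b (r 0))) a := by
      intro a
      have := ((EuclideanSpace.proj (𝕜 := ℝ) a).hasFDerivAt.comp x hd.hasFDerivAt).fderiv
      exact congrArg (fun T : E →L[ℝ] ℝ => T (b (r 0))) this
    simp only [h2]
    conv_lhs => rw [← (EuclideanSpace.basisFun (Fin p) ℝ).sum_repr (fderiv ℝ v x (b (r 0)))]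
    refine (norm_sum_le _ _).trans (Finset.sum_le_sum fun a _ => ?_)
    rw [norm_smul, OrthonormalBasis.norm_eq_one, mul_one]
    simp
  calc ‖iteratedFDeriv ℝ 1 v x‖ ^ 2 ≤
      (∑ q : (Fin 1 → ι) × Fin p, |fderiv ℝ (fun y => v y q.2) x (b (q.1 0))|) ^ 2 := by gcongr
    _ ≤ _ := by
      refine (sq_sum_le_card_mul_sum_sq).trans_eq ?_
      simp only [sq_abs, Finset.card_univ]

theorem SchwartzMap.norm_iteratedFDeriv_clm_comp_le {W : Type*} [NormedAddCommGroup W]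
    [NormedSpace ℝ W] (L : V →L[ℝ] W) (h : 𝓢(E, V)) (j : ℕ) (x : E) :
    ‖iteratedFDeriv ℝ j (fun x => L (h x)) x‖ ≤ ‖L‖ * ‖iteratedFDeriv ℝ j h x‖ :=
  L.norm_iteratedFDeriv_comp_left (f := h) (h.smooth ⊤).contDiffAt (N := ∞) (mod_cast le_top)

variable [FiniteDimensional ℝ E] [MeasurableSpace E] [BorelSpace E]

theorem SchwartzMap.eLpNorm_fderiv_clm_comp_sq_le (ℓ : V →L[ℝ] ℝ) (h : 𝓢(E, V)) {S T : ℝ}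
    (hS : ∀ x, ‖h x‖ ≤ S)
    (hT : eLpNorm (fun x => iteratedFDeriv ℝ 2 h x) 2 volume ≤ ENNReal.ofReal T)
    (e : E) (he : ‖e‖ = 1) :
    eLpNorm (fun x => (fderiv ℝ (fun y => ℓ (h y)) x e) ^ 2) 2 volume ≤
      ENNReal.ofReal (3 * ‖ℓ‖ ^ 2 * S * T) := by
  have hS0 : 0 ≤ S := (norm_nonneg _).trans (hS 0)
  let w : 𝓢(E, ℝ) := h.postcompCLM ℓ
  have hw : ⇑w = fun y => ℓ (h y) := rfl
  have h1 := w.eLpNorm_fderiv_apply_sq_le e he (S := ‖ℓ‖ * S) fun x =>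
    (ℓ.le_opNorm (h x)).trans (mul_le_mul_of_nonneg_left (hS x) (norm_nonneg _))
  rw [hw] at h1
  refine h1.trans ?_
  have h2 : eLpNorm (fun x => iteratedFDeriv ℝ 2 (fun y => ℓ (h y)) x) 2 volume ≤
      ENNReal.ofReal ‖ℓ‖ * ENNReal.ofReal T :=
    (eLpNorm_le_mul_eLpNorm_of_ae_le_mul (Filter.Eventually.of_forall fun x =>
      SchwartzMap.norm_iteratedFDeriv_clm_comp_le ℓ h 2 x) 2).trans (mul_le_mul_right hT _)
  refine (mul_le_mul_right h2 _).trans_eq ?_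
  rw [← ENNReal.ofReal_mul (norm_nonneg _), ← ENNReal.ofReal_mul (by positivity)]
  congr 1
  ring

theorem SchwartzMap.eLpNorm_iteratedFDeriv_one_clm_comp_sq_le
    (L : V →L[ℝ] EuclideanSpace ℝ (Fin p)) :
    ∃ C : ℝ, 0 ≤ C ∧ ∀ (h : 𝓢(E, V)) (S T : ℝ), (∀ x, ‖h x‖ ≤ S) → 0 ≤ T →
      eLpNorm (fun x => iteratedFDeriv ℝ 2 h x) 2 volume ≤ ENNReal.ofReal T →
      eLpNorm (fun x => ‖iteratedFDeriv ℝ 1 (fun y => L (h y)) x‖ ^ 2) 2 volume ≤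
        ENNReal.ofReal (C * (S * T)) := by
  classical
  let b := stdOrthonormalBasis ℝ E
  let Q := (Fin 1 → Fin (Module.finrank ℝ E)) × Fin p
  let ℓ : Fin p → V →L[ℝ] ℝ := fun a => (EuclideanSpace.proj (𝕜 := ℝ) a).comp L
  refine ⟨Fintype.card Q * ∑ q : Q, 3 * ‖ℓ q.2‖ ^ 2, by positivity, fun h S T hS hT0 hT => ?_⟩
  have hS0 : 0 ≤ S := (norm_nonneg _).trans (hS 0)
  have hv : ContDiff ℝ ∞ fun y => L (h y) := L.contDiff.comp (h.smooth ⊤)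
  let D : Q → E → ℝ := fun q x => (fderiv ℝ (fun y => ℓ q.2 (h y)) x (b (q.1 0))) ^ 2
  have hD : ∀ q, AEStronglyMeasurable (D q) volume := by
    intro q
    have : ContDiff ℝ ∞ fun y => ℓ q.2 (h y) := (ℓ q.2).contDiff.comp (h.smooth ⊤)
    exact (((this.continuous_fderiv (by simp)).clm_apply continuous_const).pow 2).aestronglyMeasurable
  have hpt : ∀ x, ‖‖iteratedFDeriv ℝ 1 (fun y => L (h y)) x‖ ^ 2‖ ≤
      (Fintype.card Q : ℝ) * ‖(∑ q, D q) x‖ := by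
    intro x
    rw [Finset.sum_apply, Real.norm_of_nonneg (by positivity),
      Real.norm_of_nonneg (Finset.sum_nonneg fun q _ => sq_nonneg _)]
    exact norm_iteratedFDeriv_one_sq_le b hv x
  refine (eLpNorm_le_mul_eLpNorm_of_ae_le_mul (Filter.Eventually.of_forall hpt) 2).trans ?_
  have hs : eLpNorm (∑ q, D q) 2 volume ≤ ∑ q : Q, ENNReal.ofReal (3 * ‖ℓ q.2‖ ^ 2 * S * T) :=
    (eLpNorm_sum_le (fun q _ => hD q) one_le_two).trans
      (Finset.sum_le_sum fun q _ => SchwartzMap.eLpNorm_fderiv_clm_comp_sq_le (ℓ q.2) h hS hT _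
        (b.norm_eq_one _))
  refine (mul_le_mul_right hs _).trans_eq ?_
  rw [← ENNReal.ofReal_sum_of_nonneg (fun _ _ => by positivity),
    ← ENNReal.ofReal_mul (by positivity)]
  congr 1
  rw [mul_assoc, Finset.sum_mul]
  congr 1
  exact Finset.sum_congr rfl fun q _ => by ring

variable [CompleteSpace V]

theorem exists_sobolevDerivBound {m : ℕ}
    (hm : 2 ≤ m ∧ Module.finrank ℝ E ≤ 3 ∨ m = 1) (L : V →L[ℝ] EuclideanSpace ℝ (Fin p)) :
    ∃ C : ℝ, 0 ≤ C ∧ ∀ g : 𝓢(E, V), SobolevDerivBound m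
      (fun x => L (SchwartzMap.fourierMultiplierCLM V (besselSymbol (-m : ℝ)) g x))
      (C * ‖g.toLp 2‖) := by
  -- The range condition sits inside the existential, with default constant `0`, so that `choose`
  -- yields constants for all `j`.
  have h1 : ∀ j : ℕ, ∃ C : ℝ, 0 ≤ C ∧ (j ≤ m → ∀ g : 𝓢(E, V),
      eLpNorm (fun x => iteratedFDeriv ℝ j
        (SchwartzMap.fourierMultiplierCLM V (besselSymbol (-m : ℝ)) g) x) 2 volume ≤
        ENNReal.ofReal (C * ‖g.toLp 2‖)) := by
    intro j
    by_cases hj : j ≤ m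
    · obtain ⟨C, hC0, hC⟩ := exists_eLpNorm_iteratedFDeriv_bessel_le (E := E) (V := V) m j hj
      exact ⟨C, hC0, fun _ => hC⟩
    · exact ⟨0, le_rfl, fun h => absurd h hj⟩
  have h2 : ∀ j : ℕ, ∃ C : ℝ, 0 ≤ C ∧ (j + 2 ≤ m → ∀ (g : 𝓢(E, V)) (x : E),
      ‖iteratedFDeriv ℝ j
        (SchwartzMap.fourierMultiplierCLM V (besselSymbol (-m : ℝ)) g) x‖ ≤
          C * ‖g.toLp 2‖) := by
    intro j
    by_cases hj : j + 2 ≤ m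
    · have hE : Module.finrank ℝ E ≤ 3 := by omega
      obtain ⟨C, hC0, hC⟩ := exists_norm_iteratedFDeriv_bessel_le (V := V) hE m j hj
      exact ⟨C, hC0, fun _ => hC⟩
    · exact ⟨0, le_rfl, fun h => absurd h hj⟩
  choose C₁ hC₁0 hC₁ using h1
  choose C₂ hC₂0 hC₂ using h2
  obtain ⟨C₃, hC₃0, hC₃⟩ := SchwartzMap.eLpNorm_iteratedFDeriv_one_clm_comp_sq_le (E := E) L
  set A : ℝ := ∑ j ∈ Finset.range (m + 1), (‖L‖ * C₁ j + ‖L‖ * C₂ j)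
  have hA0 : 0 ≤ A := Finset.sum_nonneg fun j _ => by
    have := hC₁0 j; have := hC₂0 j; positivity
  have hAj : ∀ j ≤ m, ‖L‖ * C₁ j + ‖L‖ * C₂ j ≤ A := fun j hj =>
    Finset.single_le_sum (f := fun j => ‖L‖ * C₁ j + ‖L‖ * C₂ j)
      (fun j _ => by have := hC₁0 j; have := hC₂0 j; positivity)
      (Finset.mem_range.2 (Nat.lt_succ_of_le hj))
  set D : ℝ := C₃ * (C₂ 0 * C₁ 2) with hD
  have hD0 : 0 ≤ D := by
    have := hC₁0 2; have := hC₂0 0; positivity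
  -- `A` serves the two linear bounds. The quadratic bound needs `D ≤ (A + D + 1)²`, which holds
  -- because the base is at least `1` and at least `D`.
  refine ⟨A + (D + 1), by positivity, fun g => ?_⟩
  set h := SchwartzMap.fourierMultiplierCLM V (besselSymbol (-m : ℝ) : E → ℝ) g
  have hg := norm_nonneg (g.toLp 2)
  refine ⟨by positivity, L.contDiff.comp (h.smooth ⊤), fun j hj => ?_, fun j hj x => ?_,
    fun hm2 => ?_⟩
  · refine (eLpNorm_le_mul_eLpNorm_of_ae_le_mul (Filter.Eventually.of_forall fun x =>
      SchwartzMap.norm_iteratedFDeriv_clm_comp_le L h j x) 2).trans ?_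
    refine (mul_le_mul_right (hC₁ j hj g) _).trans ?_
    rw [← ENNReal.ofReal_mul (norm_nonneg _), ← mul_assoc]
    refine ENNReal.ofReal_le_ofReal (mul_le_mul_of_nonneg_right ?_ hg)
    have := hAj j hj
    have := mul_nonneg (norm_nonneg L) (hC₂0 j)
    linarith
  · refine (SchwartzMap.norm_iteratedFDeriv_clm_comp_le L h j x).trans ?_
    refine (mul_le_mul_of_nonneg_left (hC₂ j hj g x) (norm_nonneg _)).trans ?_
    rw [← mul_assoc]
    refine mul_le_mul_of_nonneg_right ?_ hg
    have := hAj j (by omega)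
    have := mul_nonneg (norm_nonneg L) (hC₁0 j)
    linarith
  · have hS : ∀ x, ‖h x‖ ≤ C₂ 0 * ‖g.toLp 2‖ := fun x => by
      have := hC₂ 0 (by omega) g x
      rwa [norm_iteratedFDeriv_zero] at this
    have hT := hC₁ 2 (by omega) g
    have hT0 : 0 ≤ C₁ 2 * ‖g.toLp 2‖ := mul_nonneg (hC₁0 2) hg
    have h3 := hC₃ h _ _ hS hT0 hT
    refine h3.trans (ENNReal.ofReal_le_ofReal ?_)
    have hDA : D ≤ (A + (D + 1)) ^ 2 := by nlinarith
    have hmul := mul_le_mul_of_nonneg_right hDA (sq_nonneg ‖g.toLp 2‖)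
    rw [hD] at hmul ⊢
    generalize ‖g.toLp 2‖ = a at hmul ⊢
    linarith only [hmul]

/-- The a priori estimate: a smooth nonlinearity vanishing near the origin, with derivatives
bounded like those of a homogeneous function of degree `m`, maps smooth functions to `H^m`. -/
theorem exists_bessel_comp_bound {W : Type*} [NormedAddCommGroup W] [InnerProductSpace ℂ W]
    [CompleteSpace W] {m : ℕ} (hm : 2 ≤ m ∧ Module.finrank ℝ E ≤ 3 ∨ m = 1)
    (L : V →L[ℝ] EuclideanSpace ℝ (Fin p)) (C : ℝ) (hC0 : 0 ≤ C) :
    ∃ K : ℝ, 0 ≤ K ∧ ∀ G : EuclideanSpace ℝ (Fin p) → W, ContDiff ℝ ∞ G →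
      (∀ j ≤ m, ∀ y, ‖iteratedFDeriv ℝ j G y‖ ≤ C * ‖y‖ ^ (m - j)) →
      (∃ δ > 0, ∀ y, ‖y‖ < δ → G y = 0) → ∀ g : 𝓢(E, V), ∃ f : 𝓢(E, W),
        (∀ x, f x = G (L (SchwartzMap.fourierMultiplierCLM V (besselSymbol (-m : ℝ)) g x))) ∧
        ‖(SchwartzMap.fourierMultiplierCLM W (besselSymbol (m : ℝ)) f).toLp 2‖ ≤
          K * ‖g.toLp 2‖ ^ m := by
  obtain ⟨A, hA0, hA⟩ := exists_sobolevDerivBound (E := E) (V := V) hm L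
  have hm1 : 1 ≤ m := by omega
  obtain ⟨N, hN0, hN⟩ := exists_eLpNorm_bessel_le (E := E) (V := W) (m - 1)
  rw [Nat.sub_add_cancel hm1] at hN
  refine ⟨N * (C * A ^ m + Fintype.card (OrderedFinpartition m) * C * A ^ m), by positivity,
    fun G hG hGC ⟨δ, hδ, hGδ⟩ g => ?_⟩
  set h := SchwartzMap.fourierMultiplierCLM V (besselSymbol (-m : ℝ) : E → ℝ) g
  have hv := hA g
  -- `L ∘ h` tends to `0` at infinity and `G` vanishes near `0`, so the composition is smooth with
  -- compact support, hence Schwartz.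
  have hsupp : HasCompactSupport fun x => G (L (h x)) := by
    have h0 : Filter.Tendsto (fun x => ‖L (h x)‖) (Filter.cocompact E) (nhds 0) := by
      have h1 := (L.continuous.tendsto 0).comp (zero_at_infty h)
      simpa using h1.norm
    have h2 := h0.eventually (gt_mem_nhds hδ)
    rw [Filter.eventually_iff, Filter.mem_cocompact] at h2
    obtain ⟨t, ht, hts⟩ := h2
    exact HasCompactSupport.intro ht fun x hx => hGδ _ (hts hx)
  let f : 𝓢(E, W) := hsupp.toSchwartzMap (hG.comp hv.contDiff)
  refine ⟨f, fun x => rfl, ?_⟩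
  have hg := norm_nonneg (g.toLp 2)
  rw [← ENNReal.ofReal_le_ofReal_iff (by positivity), SchwartzMap.ofReal_norm_toLp_two]
  refine (hN f).trans ?_
  have hf : ⇑f = G ∘ fun x => L (h x) := rfl
  rw [hf]
  refine (mul_le_mul_right (add_le_add (hv.eLpNorm_comp_le hm1 hC0 hGC)
    (hv.eLpNorm_iteratedFDeriv_comp_le hm1 hG hC0 hGC)) _).trans_eq ?_
  rw [← ENNReal.ofReal_add (by positivity) (by positivity), ← ENNReal.ofReal_mul hN0]
  congr 1
  ring

end APriori

/-! ### Bessel potentials on `L²`, and closure of `H^s` bounds under `L²` limits. -/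

section BesselClosure

open TemperedDistribution Filter
open scoped Topology

variable {E V : Type*} [NormedAddCommGroup E] [InnerProductSpace ℝ E]

theorem besselSymbol_ofReal_hasTemperateGrowth (s : ℝ) :
    (fun ξ : E => (besselSymbol s ξ : ℂ)).HasTemperateGrowth := by
  unfold besselSymbol
  fun_prop

variable [FiniteDimensional ℝ E]
  [MeasurableSpace E] [BorelSpace E] [NormedAddCommGroup V] [InnerProductSpace ℂ V]
  [CompleteSpace V]

theorem MeasureTheory.Lp.eq_of_toTemperedDistribution_eq {f g : Lp V 2 (volume : Measure E)}
    (h : (f : 𝓢'(E, V)) = (g : 𝓢'(E, V))) : f = g :=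
  LinearMap.ker_eq_bot.mp (Lp.ker_toTemperedDistributionCLM_eq_bot (E := E) (F := V)
    (μ := (volume : Measure E)) (p := 2)) h

theorem besselSymbol_memLp_top {s : ℝ} (hs : 0 ≤ s) :
    MemLp (fun ξ : E => (besselSymbol (-s) ξ : ℂ)) ⊤ volume := by
  refine memLp_top_of_bound
    (besselSymbol_ofReal_hasTemperateGrowth (-s)).1.continuous.aestronglyMeasurable 1
    (Eventually.of_forall fun ξ => ?_)
  rw [Complex.norm_real, Real.norm_of_nonneg (besselSymbol_pos _ _).le]
  exact besselSymbol_le_one (by linarith) ξ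

theorem norm_besselSymbol_toLp_le_one {s : ℝ} (hs : 0 ≤ s) :
    ‖(besselSymbol_memLp_top (E := E) hs).toLp _‖ ≤ 1 := by
  rw [Lp.norm_toLp]
  refine ENNReal.toReal_le_of_le_ofReal zero_le_one ?_
  rw [eLpNorm_exponent_top]
  refine eLpNormEssSup_le_of_ae_bound (Eventually.of_forall fun ξ => ?_)
  rw [Complex.norm_real, Real.norm_of_nonneg (besselSymbol_pos _ _).le]
  exact besselSymbol_le_one (by linarith) ξ

theorem TemperedDistribution.fourier_besselPotential_toLp (s : ℝ)
    (f : Lp V 2 (volume : Measure E)) :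
    𝓕 (besselPotential E V s (f : 𝓢'(E, V))) =
      smulLeftCLM V (fun ξ => (besselSymbol s ξ : ℂ)) 
        ((𝓕 f : Lp V 2 (volume : Measure E)) : 𝓢'(E, V)) := by
  rw [fourier_besselPotential_eq_smulLeftCLM_fourier_apply, Lp.fourier_toTemperedDistribution_eq]
  rfl

/-- `f` is the potential of order `-s` of `g`, whose symbol is at most `1`; conclude by Plancherel.
-/
theorem norm_le_of_besselPotential_eq {s : ℝ} (hs : 0 ≤ s) {f g : Lp V 2 (volume : Measure E)}
    (h : besselPotential E V s (f : 𝓢'(E, V)) = (g : 𝓢'(E, V))) : ‖f‖ ≤ ‖g‖ := by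
  have h1 : besselPotential E V (-s) (g : 𝓢'(E, V)) = f := by
    rw [besselPotential_neg_apply_eq_iff, h]
  have h2 : (𝓕 f : Lp V 2 (volume : Measure E)) =
      (besselSymbol_memLp_top (E := E) hs).toLp _ • (𝓕 g : Lp V 2 (volume : Measure E)) := by
    apply MeasureTheory.Lp.eq_of_toTemperedDistribution_eq
    rw [Lp.toTemperedDistribution_smul_eq (besselSymbol_ofReal_hasTemperateGrowth (-s)),
      ← TemperedDistribution.fourier_besselPotential_toLp, h1,
      Lp.fourier_toTemperedDistribution_eq]
  rw [← Lp.norm_fourier_eq f, ← Lp.norm_fourier_eq g, h2]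
  refine (Lp.norm_smul_le _ _).trans ?_
  exact mul_le_of_le_one_left (norm_nonneg _) (norm_besselSymbol_toLp_le_one hs)

theorem SchwartzMap.besselPotential_toLp (s : ℝ) (f : 𝓢(E, V)) :
    besselPotential E V s ((f.toLp 2 : Lp V 2 (volume : Measure E)) : 𝓢'(E, V)) =
      (((SchwartzMap.fourierMultiplierCLM V (besselSymbol s) f).toLp 2 :
        Lp V 2 (volume : Measure E)) : 𝓢'(E, V)) := by
  rw [besselPotential, Lp.toTemperedDistribution_toLp_eq, Lp.toTemperedDistribution_toLp_eq,
    fourierMultiplierCLM_toTemperedDistributionCLM_eq (by fun_prop)]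
  congr 1
  exact SchwartzMap.fourierMultiplierCLM_ofReal ℂ (besselSymbol_hasTemperateGrowth s) f

theorem SchwartzMap.besselPotential_toLp_fourierMultiplierCLM_neg (s : ℝ) (g : 𝓢(E, V)) :
    besselPotential E V s (((SchwartzMap.fourierMultiplierCLM V (besselSymbol (-s)) g).toLp 2 :
        Lp V 2 (volume : Measure E)) : 𝓢'(E, V)) =
      ((g.toLp 2 : Lp V 2 (volume : Measure E)) : 𝓢'(E, V)) := by
  rw [← SchwartzMap.besselPotential_toLp]
  simp

/-- The symbol of order `s` is unbounded and does not act on `L²`. Writing `𝓕 f` as the bounded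
symbol of order `-s` times the weighted transform lets the two symbols cancel among tempered
distributions. -/
theorem besselPotential_eq_of_memLp {s : ℝ} (hs : 0 ≤ s)
    {f : Lp V 2 (volume : Measure E)}
    (h : MemLp (fun ξ => besselSymbol s ξ • (𝓕 f : Lp V 2 (volume : Measure E)) ξ) 2 volume) :
    besselPotential E V s (f : 𝓢'(E, V)) =
      ((𝓕⁻ (h.toLp _) : Lp V 2 (volume : Measure E)) : 𝓢'(E, V)) := by
  have h1 : (𝓕 f : Lp V 2 (volume : Measure E)) =
      (besselSymbol_memLp_top (E := E) hs).toLp _ • h.toLp _ := by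
    refine Lp.ext ?_
    filter_upwards [Lp.coeFn_lpSMul (r := 2) ((besselSymbol_memLp_top (E := E) hs).toLp _)
      (h.toLp _), (besselSymbol_memLp_top (E := E) hs).coeFn_toLp, h.coeFn_toLp] with ξ h2 h3 h4
    rw [h2, Pi.smul_apply', h3, h4, Complex.coe_smul, smul_smul, ← besselSymbol_add,
      neg_add_cancel, besselSymbol_zero, one_smul]
  have h2 : 𝓕 (besselPotential E V s (f : 𝓢'(E, V))) =
      ((h.toLp _ : Lp V 2 (volume : Measure E)) : 𝓢'(E, V)) := by
    rw [TemperedDistribution.fourier_besselPotential_toLp]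
    generalize h.toLp _ = G at h1 ⊢
    rw [h1,
      Lp.toTemperedDistribution_smul_eq (besselSymbol_ofReal_hasTemperateGrowth (-s)),
      smulLeftCLM_smulLeftCLM_apply (besselSymbol_ofReal_hasTemperateGrowth _)
        (besselSymbol_ofReal_hasTemperateGrowth _)]
    have h3 : ((fun ξ : E => (besselSymbol s ξ : ℂ)) * fun ξ => (besselSymbol (-s) ξ : ℂ)) =
        fun _ => 1 := by
      ext ξ
      rw [Pi.mul_apply, ← Complex.ofReal_mul, ← besselSymbol_add, add_neg_cancel,
        besselSymbol_zero, Complex.ofReal_one]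
    rw [mul_comm, h3, smulLeftCLM_const, one_smul]
  rw [← Lp.fourierInv_toTemperedDistribution_eq, ← h2, FourierTransform.fourierInv_fourier_eq]

/-- By Plancherel the Fourier transforms converge in `L²`, hence almost everywhere along a
subsequence. The weighted transforms then converge almost everywhere too, and Fatou's lemma bounds
the limit by `M₀`. -/
theorem exists_besselPotential_eq_of_tendsto {s : ℝ} (hs : 0 ≤ s)
    {f : Lp V 2 (volume : Measure E)} {φ : ℕ → 𝓢(E, V)}
    (hφ : Tendsto (fun k => (φ k).toLp 2) atTop (𝓝 f)) {M : ℕ → ℝ} {M₀ : ℝ}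
    (hM : Tendsto M atTop (𝓝 M₀))
    (hb : ∀ k, ‖(SchwartzMap.fourierMultiplierCLM V (besselSymbol s) (φ k)).toLp 2‖ ≤ M k) :
    ∃ g : Lp V 2 (volume : Measure E),
      besselPotential E V s (f : 𝓢'(E, V)) = (g : 𝓢'(E, V)) ∧ ‖g‖ ≤ M₀ := by
  have hM0 : 0 ≤ M₀ := ge_of_tendsto' hM fun k => (norm_nonneg _).trans (hb k)
  have hF : Tendsto (fun k => (𝓕 ((φ k).toLp 2) : Lp V 2 (volume : Measure E))) atTop
      (𝓝 (𝓕 f : Lp V 2 (volume : Measure E))) :=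
    ((Lp.fourierTransformₗᵢ E V).continuous.tendsto f).comp hφ
  obtain ⟨ns, hns, hae⟩ := (tendstoInMeasure_of_tendsto_Lp hF).exists_seq_tendsto_ae
  have hcoe : ∀ᵐ ξ, ∀ k, (𝓕 ((φ k).toLp 2) : Lp V 2 (volume : Measure E)) ξ =
      (𝓕 (φ k) : 𝓢(E, V)) ξ := by
    rw [ae_all_iff]
    intro k
    rw [SchwartzMap.toLp_fourier_eq]
    exact SchwartzMap.coeFn_toLp _ _ _
  have hlim : ∀ᵐ ξ, Tendsto (fun k =>
      (𝓕 (SchwartzMap.fourierMultiplierCLM V (besselSymbol s) (φ (ns k))) : 𝓢(E, V)) ξ) atTop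
      (𝓝 (besselSymbol s ξ • (𝓕 f : Lp V 2 (volume : Measure E)) ξ)) := by
    filter_upwards [hae, hcoe] with ξ h1 h2
    simp only [SchwartzMap.fourier_fourierMultiplierCLM (besselSymbol_hasTemperateGrowth s)]
    simp only [h2] at h1
    exact h1.const_smul _
  have hle : eLpNorm (fun ξ => besselSymbol s ξ • (𝓕 f : Lp V 2 (volume : Measure E)) ξ) 2 volume
      ≤ ENNReal.ofReal M₀ := by
    refine (Lp.eLpNorm_lim_le_liminf_eLpNorm (fun k =>
      (SchwartzMap.continuous _).aestronglyMeasurable) _ hlim).trans ?_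
    have h1 : Tendsto (fun k => ENNReal.ofReal (M (ns k))) atTop (𝓝 (ENNReal.ofReal M₀)) :=
      ENNReal.tendsto_ofReal (hM.comp hns.tendsto_atTop)
    rw [← h1.liminf_eq]
    refine liminf_le_liminf (Eventually.of_forall fun k => ?_)
    rw [SchwartzMap.eLpNorm_fourier_two, ← SchwartzMap.ofReal_norm_toLp_two]
    exact ENNReal.ofReal_le_ofReal (hb _)
  have hmem : MemLp (fun ξ => besselSymbol s ξ • (𝓕 f : Lp V 2 (volume : Measure E)) ξ) 2
      volume :=
    ⟨(besselSymbol_hasTemperateGrowth s).1.continuous.aestronglyMeasurable.smul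
      (Lp.aestronglyMeasurable _), hle.trans_lt ENNReal.ofReal_lt_top⟩
  refine ⟨_, besselPotential_eq_of_memLp hs hmem, ?_⟩
  have h1 : ‖(𝓕⁻ (hmem.toLp _) : Lp V 2 (volume : Measure E))‖ = ‖hmem.toLp _‖ :=
    (Lp.fourierTransformₗᵢ E V).symm.norm_map _
  rw [h1, Lp.norm_toLp]
  exact ENNReal.toReal_le_of_le_ofReal hM0 hle

end BesselClosure

/-! ### `L²` convergence of the regularised compositions. -/

section Limit

open Filter
open scoped Topology

theorem tendsto_eLpNorm_two_zero_of_dominated {α W : Type*} [MeasurableSpace α] {μ : Measure α}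
    [NormedAddCommGroup W] {f : ℕ → α → W} {b : α → ℝ}
    (hf : ∀ k, AEStronglyMeasurable (f k) μ) (hb : MemLp b 2 μ)
    (hle : ∀ k, ∀ᵐ x ∂μ, ‖f k x‖ ≤ ‖b x‖)
    (hlim : ∀ᵐ x ∂μ, Tendsto (fun k => f k x) atTop (𝓝 0)) :
    Tendsto (fun k => eLpNorm (f k) 2 μ) atTop (𝓝 0) := by
  have h1 : Tendsto (fun k => ∫⁻ x, ‖f k x‖ₑ ^ (2 : ℝ) ∂μ) atTop (𝓝 (∫⁻ _, 0 ∂μ)) := by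
    refine tendsto_lintegral_of_dominated_convergence' (fun x => ‖b x‖ₑ ^ (2 : ℝ))
      (fun k => (hf k).enorm.pow_const _) (fun k => ?_) ?_ ?_
    · filter_upwards [hle k] with x hx
      gcongr
      exact enorm_le_iff_norm_le.2 hx
    · have := lintegral_rpow_enorm_lt_top_of_eLpNorm_lt_top two_ne_zero ENNReal.ofNat_ne_top hb.2
      exact ne_of_lt (by simpa using this)
    · filter_upwards [hlim] with x hx
      have h2 := ((ENNReal.continuous_rpow_const (y := (2 : ℝ))).tendsto _).comp
        ((continuous_enorm.tendsto _).comp hx)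
      simpa [Function.comp_def] using h2
  have h2 := ((ENNReal.continuous_rpow_const (y := (1 / 2 : ℝ))).tendsto _).comp h1
  simp only [lintegral_zero] at h2
  rw [ENNReal.zero_rpow_of_pos (by norm_num)] at h2
  refine h2.congr fun k => ?_
  rw [eLpNorm_eq_lintegral_rpow_enorm_toReal two_ne_zero ENNReal.ofNat_ne_top]
  simp

variable {α Y W : Type*} [MeasurableSpace α] {μ : Measure α} [NormedAddCommGroup Y]
  [NormedAddCommGroup W] {G : ℕ → Y → W} {F : Y → W} {C R : ℝ} {m : ℕ} {v : ℕ → α → Y} {u : α → Y}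

theorem norm_sub_le_two_mul_of_tendsto (hm : 1 ≤ m) (hC0 : 0 ≤ C)
    (hG0 : ∀ k y, ‖G k y‖ ≤ C * ‖y‖ ^ m) (hGF : ∀ y, Tendsto (fun k => G k y) atTop (𝓝 (F y)))
    {y : Y} (hy : ‖y‖ ^ (m - 1) ≤ R) (k : ℕ) : ‖G k y - F y‖ ≤ 2 * C * R * ‖y‖ := by
  have hF : ‖F y‖ ≤ C * ‖y‖ ^ m := le_of_tendsto (hGF y).norm (Eventually.of_forall fun k => hG0 k y)
  have h1 : ‖y‖ ^ m ≤ R * ‖y‖ := by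
    rw [← Nat.sub_add_cancel hm, pow_succ]
    gcongr
  calc _ ≤ ‖G k y‖ + ‖F y‖ := norm_sub_le _ _
    _ ≤ C * ‖y‖ ^ m + C * ‖y‖ ^ m := add_le_add (hG0 k y) hF
    _ ≤ C * (R * ‖y‖) + C * (R * ‖y‖) := by gcongr
    _ = _ := by ring

/-- Insert `G k (u x)`: the first difference is handled by the Lipschitz bound uniform in `k`, the
second by dominated convergence. Bounding `‖·‖^(m-1)` rather than `‖·‖` demands no sup bound when `m
= 1`. -/
theorem tendsto_eLpNorm_comp_sub_comp (hm : 1 ≤ m) (hC0 : 0 ≤ C) (hR0 : 0 ≤ R)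
    (hGc : ∀ k, Continuous (G k)) (hG0 : ∀ k y, ‖G k y‖ ≤ C * ‖y‖ ^ m)
    (hG1 : ∀ k a b, ‖G k a - G k b‖ ≤ C * max ‖a‖ ‖b‖ ^ (m - 1) * ‖a - b‖)
    (hGF : ∀ y, Tendsto (fun k => G k y) atTop (𝓝 (F y)))
    (hu : MemLp u 2 μ) (hv : ∀ k, AEStronglyMeasurable (v k) μ)
    (huR : ∀ᵐ x ∂μ, ‖u x‖ ^ (m - 1) ≤ R) (hvR : ∀ k, ∀ᵐ x ∂μ, ‖v k x‖ ^ (m - 1) ≤ R)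
    (hvu : Tendsto (fun k => eLpNorm (fun x => v k x - u x) 2 μ) atTop (𝓝 0)) :
    Tendsto (fun k => eLpNorm (fun x => G k (v k x) - F (u x)) 2 μ) atTop (𝓝 0) := by
  have hGu : ∀ k, AEStronglyMeasurable (fun x => G k (u x)) μ := fun k =>
    (hGc k).comp_aestronglyMeasurable hu.1
  have hFu : AEStronglyMeasurable (fun x => F (u x)) μ :=
    aestronglyMeasurable_of_tendsto_ae atTop hGu (Eventually.of_forall fun x => hGF (u x))
  have hA : Tendsto (fun k => eLpNorm (fun x => G k (v k x) - G k (u x)) 2 μ) atTop (𝓝 0) := by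
    have h1 : ∀ k, eLpNorm (fun x => G k (v k x) - G k (u x)) 2 μ ≤
        ENNReal.ofReal (C * R) * eLpNorm (fun x => v k x - u x) 2 μ := by
      intro k
      refine eLpNorm_le_mul_eLpNorm_of_ae_le_mul ?_ 2
      filter_upwards [huR, hvR k] with x h1 h2
      refine (hG1 k _ _).trans ?_
      gcongr
      rcases max_choice ‖v k x‖ ‖u x‖ with h | h <;> rw [h] <;> assumption
    have h2 := ENNReal.Tendsto.const_mul hvu (Or.inr (ENNReal.ofReal_ne_top (r := C * R)))
    rw [mul_zero] at h2
    exact tendsto_of_tendsto_of_tendsto_of_le_of_le tendsto_const_nhds h2 (fun _ => zero_le) h1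
  have hB : Tendsto (fun k => eLpNorm (fun x => G k (u x) - F (u x)) 2 μ) atTop (𝓝 0) := by
    refine tendsto_eLpNorm_two_zero_of_dominated (b := fun x => (2 * C * R) * ‖u x‖)
      (fun k => (hGu k).sub hFu) (hu.norm.const_mul _) (fun k => ?_) ?_
    · filter_upwards [huR] with x hx
      rw [Real.norm_of_nonneg (by positivity)]
      exact norm_sub_le_two_mul_of_tendsto hm hC0 hG0 hGF hx k
    · refine Eventually.of_forall fun x => ?_
      simpa using (hGF (u x)).sub_const (F (u x))
  have hAB := hA.add hB
  rw [add_zero] at hAB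
  refine tendsto_of_tendsto_of_tendsto_of_le_of_le tendsto_const_nhds hAB (fun _ => zero_le)
    fun k => ?_
  have h1 : (fun x => G k (v k x) - F (u x)) =
      (fun x => G k (v k x) - G k (u x)) + fun x => G k (u x) - F (u x) := by
    ext x
    simp
  rw [h1]
  exact eLpNorm_add_le (((hGc k).comp_aestronglyMeasurable (hv k)).sub (hGu k))
    ((hGu k).sub hFu) one_le_two

theorem memLp_comp_of_tendsto (hm : 1 ≤ m) (hC0 : 0 ≤ C)
    (hGc : ∀ k, Continuous (G k)) (hG0 : ∀ k y, ‖G k y‖ ≤ C * ‖y‖ ^ m)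
    (hGF : ∀ y, Tendsto (fun k => G k y) atTop (𝓝 (F y)))
    (hu : MemLp u 2 μ) (huR : ∀ᵐ x ∂μ, ‖u x‖ ^ (m - 1) ≤ R) :
    MemLp (fun x => F (u x)) 2 μ := by
  have hFu : AEStronglyMeasurable (fun x => F (u x)) μ :=
    aestronglyMeasurable_of_tendsto_ae atTop
      (fun k => (hGc k).comp_aestronglyMeasurable hu.1) (Eventually.of_forall fun x => hGF (u x))
  refine hu.of_le_mul (c := C * R) hFu ?_
  filter_upwards [huR] with x hx
  have hF : ‖F (u x)‖ ≤ C * ‖u x‖ ^ m :=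
    le_of_tendsto (hGF (u x)).norm (Eventually.of_forall fun k => hG0 k (u x))
  rw [← Nat.sub_add_cancel hm, pow_succ] at hF
  refine hF.trans ?_
  rw [mul_assoc]
  gcongr

end Limit

/-! ### Approximation of `u` and the conclusion. -/

section Main

open Filter TemperedDistribution
open scoped Topology

/-- The coordinatewise real part `ℂᵖ → ℝᵖ`. -/
noncomputable def euclideanReCLM (p : ℕ) :
    EuclideanSpace ℂ (Fin p) →L[ℝ] EuclideanSpace ℝ (Fin p) :=
  LinearMap.toContinuousLinearMap
    { toFun := fun z => WithLp.toLp 2 fun i => (z i).re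
      map_add' := fun z w => by ext i; simp
      map_smul' := fun c z => by ext i; simp }

theorem euclideanReCLM_complexify {n p : ℕ}
    (u : EuclideanSpace ℝ (Fin n) → EuclideanSpace ℝ (Fin p)) (x : EuclideanSpace ℝ (Fin n)) :
    euclideanReCLM p (complexify u x) = u x := by
  ext i
  simp [euclideanReCLM, complexify]

/-- Density of Schwartz functions in `L²` is applied to `g`, not to `f`; the potential of order `-s`
is a contraction and carries the convergence to `f`. -/
theorem exists_schwartz_tendsto_of_besselPotential_eq {E V : Type*} [NormedAddCommGroup E]
    [InnerProductSpace ℝ E] [FiniteDimensional ℝ E] [MeasurableSpace E] [BorelSpace E]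
    [NormedAddCommGroup V] [InnerProductSpace ℂ V] [CompleteSpace V] {s : ℝ} (hs : 0 ≤ s)
    {f g : Lp V 2 (volume : Measure E)}
    (h : besselPotential E V s (f : 𝓢'(E, V)) = (g : 𝓢'(E, V))) :
    ∃ φ : ℕ → 𝓢(E, V), Tendsto (fun k => (φ k).toLp 2) atTop (𝓝 g) ∧
      Tendsto (fun k => (SchwartzMap.fourierMultiplierCLM V (besselSymbol (-s)) (φ k)).toLp 2)
        atTop (𝓝 f) := by
  have hd := SchwartzMap.denseRange_toLpCLM (E := E) (F := V) (p := 2) (μ := volume)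
    ENNReal.ofNat_ne_top g
  obtain ⟨x, hx, hxg⟩ := mem_closure_iff_seq_limit.1 hd
  choose φ hφ using hx
  have hφ' : Tendsto (fun k => (φ k).toLp 2) atTop (𝓝 g) := by
    refine hxg.congr fun k => ?_
    rw [← hφ k]
    rfl
  refine ⟨φ, hφ', ?_⟩
  rw [tendsto_iff_norm_sub_tendsto_zero] at hφ' ⊢
  refine squeeze_zero (fun _ => norm_nonneg _) (fun k => ?_) hφ'
  refine norm_le_of_besselPotential_eq hs ?_
  have h1 := SchwartzMap.besselPotential_toLp_fourierMultiplierCLM_neg s (φ k)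
  rw [← Lp.toTemperedDistributionCLM_apply] at h h1 ⊢
  rw [← Lp.toTemperedDistributionCLM_apply] at h h1 ⊢
  rw [map_sub, map_sub, map_sub, h, h1]

end Main

theorem mainTheorem6 (p m n : ℕ) (hp : 1 ≤ p) (hmn : (2 ≤ m ∧ n ≤ 3) ∨ m = 1)
    (F : EuclideanSpace ℝ (Fin p) → ℂ)
    (hF : ContDiffOn ℝ ∞ F {0}ᶜ)
    (hhom : ∀ t : ℝ, 0 ≤ t → ∀ y : EuclideanSpace ℝ (Fin p), F (t • y) = (t : ℂ) ^ m * F y) :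
    ∃ K : ℝ, 0 < K ∧
      ∀ u : EuclideanSpace ℝ (Fin n) → EuclideanSpace ℝ (Fin p),
        MemH m (complexify u) →
          MemH m (fun x => F (u x)) ∧
          normH m (fun x => F (u x)) ≤ K * normH m (complexify u) ^ m := by
  have hm1 : 1 ≤ m := by omega
  have hmE : 2 ≤ m ∧ Module.finrank ℝ (EuclideanSpace ℝ (Fin n)) ≤ 3 ∨ m = 1 := by
    simpa using hmn
  -- The Schwartz approximations of `complexify u` need not be real, so `F` is composed with their
  -- real parts.
  set L := euclideanReCLM p with hL
  obtain ⟨C, hC0, hC⟩ := exists_smooth_approx_of_homogeneous hF m (fun t ht y => by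
    rw [hhom t ht y, ← Complex.ofReal_pow, Complex.real_smul])
  obtain ⟨K, hK0, hK⟩ := exists_bessel_comp_bound (E := EuclideanSpace ℝ (Fin n)) (W := ℂ) hmE L
    C hC0
  obtain ⟨A, hA0, hA⟩ := exists_sobolevDerivBound (E := EuclideanSpace ℝ (Fin n)) hmE L
  refine ⟨K + 1, by positivity, fun u hu => ?_⟩
  obtain ⟨hU, g, hg⟩ := hu
  have hε : ∀ k : ℕ, (0 : ℝ) < 1 / ((k : ℝ) + 1) := fun k => by positivity
  choose G hGs hGC hG0 hGF using fun k : ℕ => hC _ (hε k)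
  obtain ⟨φ, hφg, hφU⟩ := exists_schwartz_tendsto_of_besselPotential_eq (Nat.cast_nonneg m) hg
  choose f hf hfK using fun k => hK (G k) (hGs k) (hGC k)
    ⟨_, half_pos (hε k), hG0 k⟩ (φ k)
  set h : ℕ → 𝓢(EuclideanSpace ℝ (Fin n), EuclideanSpace ℂ (Fin p)) := fun k =>
    SchwartzMap.fourierMultiplierCLM _ (besselSymbol (-m : ℝ)) (φ k)
  have hGlim : ∀ y, Filter.Tendsto (fun k => G k y) Filter.atTop (nhds (F y)) := by
    intro y
    -- The sequence is eventually constant: identically `0` at the origin, and equal to `F y` once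
    -- `1/(k+1) ≤ ‖y‖` elsewhere.
    refine tendsto_const_nhds.congr' ?_
    by_cases hy : y = 0
    · refine Filter.Eventually.of_forall fun k => ?_
      have h1 : F 0 = 0 := by
        have := hhom 0 le_rfl 0
        simpa [Nat.one_le_iff_ne_zero.1 hm1] using this
      rw [hy, h1]
      exact (hG0 k 0 (by simpa using half_pos (hε k))).symm
    · have h1 := (tendsto_one_div_add_atTop_nhds_zero_nat (𝕜 := ℝ)).eventually
        (gt_mem_nhds (norm_pos_iff.2 hy))
      filter_upwards [h1] with k hk
      exact (hGF k y hk.le).symm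
  have hGpow : ∀ k y, ‖G k y‖ ≤ C * ‖y‖ ^ m := fun k y => by
    simpa using hGC k 0 (Nat.zero_le _) y
  have hGlip : ∀ k a b, ‖G k a - G k b‖ ≤ C * max ‖a‖ ‖b‖ ^ (m - 1) * ‖a - b‖ := fun k =>
    norm_sub_le_of_norm_fderiv_le_norm_pow (hGs k) hC0 fun y => by
      simpa [norm_iteratedFDeriv_one] using hGC k 1 hm1 y
  have huL2 : MemLp u 2 volume := by
    have h1 := L.comp_memLp' hU
    refine h1.ae_eq (Filter.Eventually.of_forall fun x => ?_)
    exact euclideanReCLM_complexify u x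
  obtain ⟨D, hD⟩ : ∃ D : ℝ, ∀ k, ‖(φ k).toLp 2 volume‖ ≤ D := by
    obtain ⟨D, hD⟩ := hφg.norm.bddAbove_range
    exact ⟨D, fun k => hD ⟨k, rfl⟩⟩
  have hD0 : 0 ≤ D := (norm_nonneg _).trans (hD 0)
  -- For `m = 1` both sides are `1`; otherwise this is the Sobolev embedding, uniform in `k` because
  -- the norms of `φ k` are bounded.
  have hvR : ∀ k x, ‖L (h k x)‖ ^ (m - 1) ≤ (A * D) ^ (m - 1) := by
    intro k x
    refine ((hA (φ k)).norm_pow_le (by omega) x).trans ?_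
    have := hD k
    gcongr
  have hvu : Filter.Tendsto (fun k => eLpNorm (fun x => L (h k x) - u x) 2 volume) Filter.atTop
      (nhds 0) := by
    have h1 : ∀ k, eLpNorm (fun x => L (h k x) - u x) 2 volume ≤
        ENNReal.ofReal ‖L‖ * eLpNorm (⇑(h k) - complexify u) 2 volume := by
      intro k
      refine eLpNorm_le_mul_eLpNorm_of_ae_le_mul (Filter.Eventually.of_forall fun x => ?_) 2
      rw [← euclideanReCLM_complexify u x, ← hL, ← map_sub]
      exact L.le_opNorm _
    have h2 := (Lp.tendsto_Lp_iff_tendsto_eLpNorm'' _ (fun k => (h k).memLp 2) _ hU).1 hφU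
    have h3 := ENNReal.Tendsto.const_mul h2 (Or.inr (ENNReal.ofReal_ne_top (r := ‖L‖)))
    rw [mul_zero] at h3
    exact tendsto_of_tendsto_of_tendsto_of_le_of_le tendsto_const_nhds h3 (fun _ => zero_le) h1
  have hvc : ∀ k, Continuous fun x => L (h k x) := fun k => L.continuous.comp (h k).continuous
  -- `u` inherits the bound along an almost everywhere convergent subsequence.
  have huR : ∀ᵐ x, ‖u x‖ ^ (m - 1) ≤ (A * D) ^ (m - 1) := by
    have h1 := tendstoInMeasure_of_tendsto_eLpNorm two_ne_zero
      (fun k => (hvc k).aestronglyMeasurable) huL2.1 hvu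
    obtain ⟨ns, -, hns⟩ := h1.exists_seq_tendsto_ae
    filter_upwards [hns] with x hx
    exact le_of_tendsto (hx.norm.pow _) (Filter.Eventually.of_forall fun k => hvR _ _)
  have hR0 : 0 ≤ (A * D) ^ (m - 1) := by positivity
  have hFu : MemLp (fun x => F (u x)) 2 volume :=
    memLp_comp_of_tendsto hm1 hC0 (fun k => (hGs k).continuous) hGpow hGlim huL2 huR
  have hlim : Filter.Tendsto (fun k => (f k).toLp 2) Filter.atTop (nhds (hFu.toLp _)) := by
    refine (Lp.tendsto_Lp_iff_tendsto_eLpNorm'' _ (fun k => (f k).memLp 2) _ hFu).2 ?_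
    refine (tendsto_eLpNorm_comp_sub_comp hm1 hC0 hR0 (fun k => (hGs k).continuous) hGpow hGlip
      hGlim huL2 (fun k => (hvc k).aestronglyMeasurable) huR
      (fun k => Filter.Eventually.of_forall (hvR k)) hvu).congr fun k => ?_
    congr 1
    ext x
    rw [Pi.sub_apply, hf]
  obtain ⟨g', hg', hle⟩ := exists_besselPotential_eq_of_tendsto (Nat.cast_nonneg m) hlim
    ((hφg.norm.pow m).const_mul K) hfK
  refine ⟨⟨hFu, g', hg'⟩, ?_⟩
  rw [normH_eq m _ hFu g' hg', normH_eq m _ hU g hg]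
  refine hle.trans ?_
  gcongr
  linarith
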